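/- For finite graphs $H,G$ let $i_H(G)$ be the number of induced copies of $H$ in $G$ (vertex subsets of $G$ inducing a graph isomorphic to $H$), let $i_H(n)$ be the maximum of $i_H(G)$ over all graphs $G$ with $n$ vertices, and, for $H$ with $h$ vertices, let $i_H=\lim_{n\to\infty} i_H(n)/\binom{n}{h}$ be the inducibility of $H$. For a graph $H$ and a vertex set $S$, the agreement set of $S$ consists of the vertices outside $S$ that are adjacent to all or to none of the vertices of $S$. A vertex set $Q$ is distinguishing if it is not contained in the agreement set of any two distinct vertices outside $Q$. A blowup of a graph replaces each vertex $i$ by a nonempty independent set (a part) $A_i$, with $A_i,A_j$ ($i\ne j$) completely joined if $ij$ is an edge and having no edges between them otherwise. A blowup $B$ is blowup $m$-close to a graph $G$ if $B$ can be made isomorphic to $G$ by changing (adding or removing) at most $m$ pairs of vertices in distinct parts and arbitrarily many pairs inside parts; otherwise it is blowup $m$-far. A bijection $\pi$ from $V(H_1)$ to $V(H_2)$ is $m$-close to an isomorphism if one can change at most $m$ pairs of $H_1$ so that $\pi$ becomes an isomorphism onto $H_2$; otherwise it is $m$-far. A graph $H$ on $[h]=\{1,\dots,h\}$ is strongly asymmetric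 if: 1. every vertex has degree larger than $0.4h$ and smaller than $0.6h$; 2. the agreement set of every pair of vertices has size at most $0.55h$, and that of every triple of vertices has size at most $0.3h$; 3. $H$ has a distinguishing set of size at most $3\log_2 h$; 4. for all $S,K\subseteq[h]$ with $|S|\le 0.7h$, every blowup of $H[S]$ with at least $0.8h$ and at most $h$ vertices, all of whose parts have at most $h/100$ vertices, is blowup $10^{-5}h^2$-far from $H[K]$; 5. for all $J,K\subseteq[h]$ with $|J|=|K|=\lceil 0.7h\rceil$, every bijection $\pi:J\to K$ with at least $0.1h$ points $x$ with $\pi(x)\neq x$ is $10^{-5}h^2$-far from an isomorphism between $H[J]$ and $H[K]$. **Theorem.** There is an absolute constant $h_0$ such that for every $h>h_0$ and every strongly asymmetric graph $H$ on $h$ vertices, the limit $i_H$ exists and $$ i_H\le\frac{h!}{h^h-h}\cdot\left(1+\frac{4}{h^{h^{1/3}}}\right). $$ -/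

import Mathlib

open Filter Topology

namespace Inducibility

/-- The number of induced copies of `H` in `G`: the number of vertex sets of `G` that induce
a graph isomorphic to `H`. -/
noncomputable def inducedCopies {V W : Type*} (H : SimpleGraph V) (G : SimpleGraph W) : ℕ :=
  {S : Set W | Nonempty (G.induce S ≃g H)}.ncard

/-- The maximum number of induced copies of `H` in a graph with `n` vertices. -/
noncomputable def maxInducedCopies {V : Type*} (H : SimpleGraph V) (n : ℕ) : ℕ :=
  ⨆ G : SimpleGraph (Fin n), inducedCopies H G

/-- The maximum induced density of `H` in graphs with `n` vertices. -/
noncomputable def maxInducedDensity {h : ℕ} (H : SimpleGraph (Fin h)) (n : ℕ) : ℝ :=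
  (maxInducedCopies H n : ℝ) / (n.choose h : ℝ)

/-- The inducibility of `H`. The existence of the limit is asserted separately,
as a convergence statement, wherever this value is used. -/
noncomputable def inducibility {h : ℕ} (H : SimpleGraph (Fin h)) : ℝ :=
  limUnder atTop (maxInducedDensity H)

/-- The blowup of `H` with parts of sizes `a i`: each vertex `i` becomes an independent set of
`a i` vertices, and two vertices of different parts `i`, `j` are adjacent iff `i`, `j` are
adjacent in `H`. -/
def blowup {V : Type*} (H : SimpleGraph V) (a : V → ℕ) : SimpleGraph (Σ i : V, Fin (a i)) :=
  H.comap Sigma.fst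

/-- The blowup of `H` with part sizes `a` is blowup `m`-close to `G`: it becomes isomorphic to `G`
after changing at most `m` pairs of vertices lying in different parts, and arbitrarily
many pairs inside parts. The changed graph is `B`. -/
def BlowupClose {V W : Type*} (H : SimpleGraph V) (a : V → ℕ) (G : SimpleGraph W) (m : ℝ) : Prop :=
  ∃ B : SimpleGraph (Σ i : V, Fin (a i)),
    (({e ∈ symmDiff (blowup H a).edgeSet B.edgeSet | ¬ (e.map Sigma.fst).IsDiag}.ncard : ℕ) : ℝ) ≤ m ∧
      Nonempty (B ≃g G)

/-- The bijection `f` is `m`-close to an isomorphism between `H₁` and `H₂`: after changing at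
most `m` pairs of `H₁` it becomes an isomorphism onto `H₂`. -/
def CloseToIso {V W : Type*} (H₁ : SimpleGraph V) (H₂ : SimpleGraph W) (f : V ≃ W) (m : ℝ) : Prop :=
  ∃ H₁' : SimpleGraph V,
    (((symmDiff H₁.edgeSet H₁'.edgeSet).ncard : ℕ) : ℝ) ≤ m ∧
      ∀ u v : V, H₁'.Adj u v ↔ H₂.Adj (f u) (f v)

/-- The agreement set of `S`: the vertices outside `S` that are adjacent to all vertices of `S`
or to none of them. -/
def agreementSet {V : Type*} (H : SimpleGraph V) (S : Set V) : Set V :=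
  {w | w ∉ S ∧ ((∀ s ∈ S, H.Adj w s) ∨ (∀ s ∈ S, ¬ H.Adj w s))}

/-- `Q` is distinguishing: it is not contained in the agreement set of any two vertices
outside `Q`. -/
def IsDistinguishing {V : Type*} (H : SimpleGraph V) (Q : Set V) : Prop :=
  ∀ u v : V, u ∉ Q → v ∉ Q → u ≠ v → ¬ Q ⊆ agreementSet H {u, v}

/-- Strongly asymmetric graphs on `h` vertices. -/
structure StronglyAsymmetric {h : ℕ} (H : SimpleGraph (Fin h)) : Prop where
  degree : ∀ v : Fin h,
    (4 / 10 : ℝ) * h < ((H.neighborSet v).ncard : ℝ) ∧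
      ((H.neighborSet v).ncard : ℝ) < (6 / 10 : ℝ) * h
  agreement_pair : ∀ S : Set (Fin h), S.ncard = 2 →
    ((agreementSet H S).ncard : ℝ) ≤ (55 / 100 : ℝ) * h
  agreement_triple : ∀ S : Set (Fin h), S.ncard = 3 →
    ((agreementSet H S).ncard : ℝ) ≤ (3 / 10 : ℝ) * h
  distinguishing : ∃ Q : Set (Fin h), IsDistinguishing H Q ∧
    (Q.ncard : ℝ) ≤ 3 * Real.logb 2 h
  blowup_far : ∀ (S K : Set (Fin h)) (a : S → ℕ),
    (S.ncard : ℝ) ≤ (7 / 10 : ℝ) * h →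
    (∀ i, 1 ≤ a i ∧ (a i : ℝ) ≤ (h : ℝ) / 100) →
    (8 / 10 : ℝ) * h ≤ (Nat.card (Σ i : S, Fin (a i)) : ℝ) →
    Nat.card (Σ i : S, Fin (a i)) ≤ h →
    ¬ BlowupClose (H.induce S) a (H.induce K) ((h : ℝ) ^ 2 / 10 ^ 5)
  iso_far : ∀ (J K : Set (Fin h)) (π : J ≃ K),
    J.ncard = ⌈(7 / 10 : ℝ) * h⌉₊ →
    K.ncard = ⌈(7 / 10 : ℝ) * h⌉₊ →
    (1 / 10 : ℝ) * h ≤ ({x : J | ((π x : K) : Fin h) ≠ (x : Fin h)}.ncard : ℝ) →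
    ¬ CloseToIso (H.induce J) (H.induce K) π ((h : ℝ) ^ 2 / 10 ^ 5)

end Inducibility

/-! Write `n` for the order of `G` and `η = h ^ (-h ^ (1/3))`. Every induced copy is the range of a
map in `adjMaps`, and `n.choose h` is asymptotic to `n ^ h / h!`, so it suffices to bound the number
of these maps by `(n / h) ^ h * (1 + 3 * η)`. Replacing `h ^ h` by `h ^ h - h` afterwards only
weakens the bound: copies nested inside parts belong to the error term.

Stability (`exists_partition`). Suppose there are more than `(n / h) ^ h` maps. Once a map is fixed
on a small distinguishing set `Q`, the candidate images of the other vertices form disjoint cells,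
and the maps are transversals of these cells. By AM-GM, fixing `q` positions costs only a factor `(e
* h) ^ q` (`div_pow_self_le`). Hence for some choice on `Q` the product of the cell sizes is almost
maximal: the cells cover almost everything, none is large, and few pairs between them contradict
`H`, since each pair of cells dense in contradictions would remove a definite fraction of the
transversals. So `G` is close to a blowup of `H`, with parts given by some `p`.

Rigidity (`near_id_or_large_fiber`). For a map `φ`, the mismatches of `σ = p ∘ φ` are the bad pairs
of `G` in the image of `φ`. As bad pairs are sparse, few maps have many mismatches; with few
mismatches, strong asymmetry forces `σ` to be near the identity or to have a fibre of size at least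
`0.69 * h`. The second case is rare because the parts are small.

Cleaning (`card_adjMaps_le_of_partition`). These estimates also hold for maps through a prescribed
vertex. A vertex used by many maps must fit some part (`exists_fitting_part`), so the few badly
placed vertices can be moved. Then a map near the identity that sends `y` to a vertex `v` of another
part must send the many vertices distinguishing `y` from `p v` into the small set of vertices bad
with `v`, which is rare. The remaining maps satisfy `p ∘ φ = id`, and by AM-GM there are at most `(n
/ h) ^ h` of them. -/

namespace Inducibility

/-! ### Products of sizes under a sum constraint -/

section
open scoped Classical

/-- A product of nonnegative reals with sum at most `s` is at most the product of equal factors. -/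
theorem prod_le_div_pow {ι : Type*} (I : Finset ι) (f : ι → ℝ) (hf : ∀ x ∈ I, 0 ≤ f x) {s : ℝ}
    (hs : ∑ x ∈ I, f x ≤ s) : ∏ x ∈ I, f x ≤ (s / I.card) ^ I.card := by
  rcases I.eq_empty_or_nonempty with rfl | hI
  · simp
  have hc : (0 : ℝ) < I.card := by exact_mod_cast hI.card_pos
  have key := Real.geom_mean_le_arith_mean I (fun _ => 1) f (fun _ _ => zero_le_one)
    (by simpa using hc) hf
  simp only [Real.rpow_one, Finset.sum_const, nsmul_eq_mul, mul_one, one_mul] at key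
  have hp : 0 ≤ ∏ x ∈ I, f x := Finset.prod_nonneg hf
  calc ∏ x ∈ I, f x = ((∏ x ∈ I, f x) ^ ((I.card : ℝ)⁻¹)) ^ I.card := by
        rw [← Real.rpow_natCast, ← Real.rpow_mul hp, inv_mul_cancel₀ hc.ne', Real.rpow_one]
    _ ≤ ((∑ x ∈ I, f x) / I.card) ^ I.card := by gcongr
    _ ≤ _ := by
        have := Finset.sum_nonneg hf
        gcongr

/-- The comparison `b ^ a ≤ a ^ a * e ^ (b - a)`, in the form used to compare powers with
different numbers of factors. -/
theorem div_pow_self_le {a h : ℕ} (hah : a ≤ h) (hh : 0 < h) {n : ℝ} (hn : 0 ≤ n) :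
    (n / a) ^ a ≤ n ^ a * (Real.exp 1 * h) ^ (h - a) / (h : ℝ) ^ h := by
  have hh' : (0 : ℝ) < h := by exact_mod_cast hh
  rcases Nat.eq_zero_or_pos a with rfl | ha
  · simp only [pow_zero, Nat.sub_zero, one_mul]
    rw [mul_pow, mul_div_assoc, div_self (by positivity), mul_one]
    exact one_le_pow₀ (Real.one_le_exp zero_le_one)
  have ha' : (0 : ℝ) < a := by exact_mod_cast ha
  -- This is `1 + u ≤ e ^ u` at `u = h / a - 1`, raised to the power `a`.
  have h1 : ((h : ℝ) / a) ^ a ≤ Real.exp 1 ^ (h - a) := by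
    rw [← Real.exp_nat_mul, mul_one, Nat.cast_sub hah]
    calc ((h : ℝ) / a) ^ a ≤ (Real.exp ((h : ℝ) / a - 1)) ^ a := by
          gcongr
          linarith [Real.add_one_le_exp ((h : ℝ) / a - 1)]
      _ = _ := by
          rw [← Real.exp_nat_mul]
          congr 1
          field_simp
  rw [div_pow] at h1 ⊢
  rw [div_le_iff₀ (by positivity)] at h1
  rw [div_le_div_iff₀ (by positivity) (by positivity), mul_pow]
  calc n ^ a * (h : ℝ) ^ h = n ^ a * ((h : ℝ) ^ a * (h : ℝ) ^ (h - a)) := by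
        rw [← pow_add, Nat.add_sub_cancel' hah]
    _ ≤ n ^ a * ((Real.exp 1 ^ (h - a) * a ^ a) * (h : ℝ) ^ (h - a)) := by gcongr
    _ = _ := by ring

/-! ### Counting transversals of disjoint cells -/

section Box
variable {ι V : Type*} [Fintype ι] [DecidableEq ι] [Fintype V]

/-- The maps that send each `x ∈ I` into the cell `C x` and agree with `ψ` outside `I`. -/
noncomputable def box (I : Finset ι) (C : ι → Finset V) (ψ : ι → V) : Finset (ι → V) :=
  Fintype.piFinset fun x => if x ∈ I then C x else {ψ x}

omit [Fintype V] in
theorem mem_box {I : Finset ι} {C : ι → Finset V} {ψ φ : ι → V} :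
    φ ∈ box I C ψ ↔ (∀ x ∈ I, φ x ∈ C x) ∧ ∀ x ∉ I, φ x = ψ x := by
  simp only [box, Fintype.mem_piFinset]
  constructor
  · intro hφ
    refine ⟨fun x hx => by simpa [hx] using hφ x, fun x hx => by simpa [hx] using hφ x⟩
  · rintro ⟨h1, h2⟩ x
    by_cases hx : x ∈ I
    · simpa [hx] using h1 x hx
    · simpa [hx] using h2 x hx

omit [Fintype V] in
theorem card_box (I : Finset ι) (C : ι → Finset V) (ψ : ι → V) :
    (box I C ψ).card = ∏ x ∈ I, (C x).card := by
  rw [box, Fintype.card_piFinset, ← Finset.prod_subset (Finset.subset_univ I)]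
  · exact Finset.prod_congr rfl fun x hx => by simp [hx]
  · intro x _ hx
    simp [hx]

omit [Fintype ι] [DecidableEq ι] in
theorem sum_card_cells_le {I : Finset ι} {C : ι → Finset V}
    (hC : (I : Set ι).PairwiseDisjoint C) :
    ∑ x ∈ I, ((C x).card : ℝ) ≤ Fintype.card V := by
  rw [← Nat.cast_sum, ← Finset.card_biUnion hC]
  exact_mod_cast Finset.card_le_univ _

omit [Fintype ι] [DecidableEq ι] in
theorem prod_card_cells_le {I : Finset ι} {C : ι → Finset V}
    (hC : (I : Set ι).PairwiseDisjoint C) :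
    ∏ x ∈ I, ((C x).card : ℝ) ≤ ((Fintype.card V : ℝ) / I.card) ^ I.card :=
  prod_le_div_pow I _ (fun _ _ => Nat.cast_nonneg _) (sum_card_cells_le hC)

omit [Fintype ι] in
/-- If the cells of `Z` are restricted to a set of density `β`, the product gains `β ^ |Z|`. -/
theorem prod_card_cells_inter_le {I Z : Finset ι} {C : ι → Finset V}
    (hC : (I : Set ι).PairwiseDisjoint C) (hZ : Z ⊆ I)
    {W : Finset V} {β : ℝ} (hβ : 0 < β)
    (hW : (W.card : ℝ) ≤ β * Fintype.card V) :
    ∏ x ∈ I, ((if x ∈ Z then C x ∩ W else C x).card : ℝ) ≤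
      β ^ Z.card * (2 * Fintype.card V / I.card) ^ I.card := by
  -- Rescale each restricted cell by `1 / β`. The rescaled sizes then sum to at most `|W| / β + |V|
  -- ≤ 2 * |V|`, so AM-GM applies; the doubling costs only `2 ^ |I|`.
  have h1 : ∏ x ∈ I, ((if x ∈ Z then C x ∩ W else C x).card : ℝ) =
      β ^ Z.card * ∏ x ∈ I, (if x ∈ Z then ((C x ∩ W).card : ℝ) / β else ((C x).card : ℝ)) := by
    have h2 : β ^ Z.card = ∏ x ∈ I, (if x ∈ Z then β else 1) := by
      rw [Finset.prod_ite, Finset.prod_const, Finset.prod_const_one, mul_one]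
      congr 2
      ext x
      simpa using @hZ x
    rw [h2, ← Finset.prod_mul_distrib]
    refine Finset.prod_congr rfl fun x _ => ?_
    split_ifs
    · field_simp
    · simp
  rw [h1]
  gcongr
  apply prod_le_div_pow
  · intro x _
    split_ifs <;> positivity
  have h3 : ∑ x ∈ I, ((C x).card : ℝ) ≤ Fintype.card V := sum_card_cells_le hC
  have h4 : ∑ x ∈ I, ((C x ∩ W).card : ℝ) ≤ W.card := by
    rw [← Nat.cast_sum, ← Finset.card_biUnion]
    · exact_mod_cast Finset.card_le_card (by
        intro w hw
        simp only [Finset.mem_biUnion, Finset.mem_inter] at hw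
        tauto)
    · intro x hx y hy hxy
      exact (hC hx hy hxy).mono Finset.inter_subset_left Finset.inter_subset_left
  have h5 : (∑ x ∈ I, ((C x ∩ W).card : ℝ)) / β ≤ Fintype.card V := by
    rw [div_le_iff₀ hβ]
    linarith
  calc _ ≤ ∑ x ∈ I, (((C x ∩ W).card : ℝ) / β + (C x).card) := by
        refine Finset.sum_le_sum fun x _ => ?_
        split_ifs
        · linarith [Nat.cast_nonneg (α := ℝ) (C x).card]
        · have : 0 ≤ ((C x ∩ W).card : ℝ) / β := by positivity
          linarith
    _ = (∑ x ∈ I, ((C x ∩ W).card : ℝ)) / β + ∑ x ∈ I, ((C x).card : ℝ) := by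
        rw [Finset.sum_add_distrib, Finset.sum_div]
    _ ≤ _ := by linarith

omit [Fintype ι] in
/-- Counting maps by their values on a set of positions. -/
theorem card_le_pow_mul (S : Finset (ι → V)) (P : Finset ι) {c : ℝ} (hc : 0 ≤ c)
    (hS : ∀ ψ : ι → V, ∀ S' ⊆ S, (∀ φ ∈ S', ∀ x ∈ P, φ x = ψ x) → (S'.card : ℝ) ≤ c) :
    (S.card : ℝ) ≤ (Fintype.card V : ℝ) ^ P.card * c := by
  rcases S.eq_empty_or_nonempty with rfl | ⟨φ₀, hφ₀⟩
  · simp only [Finset.card_empty, Nat.cast_zero]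
    positivity
  have h1 := Finset.card_eq_sum_card_fiberwise (f := fun φ : ι → V => fun x : P => φ x)
    (s := S) (t := Finset.univ) (by simp)
  rw [h1, Nat.cast_sum]
  calc _ ≤ ∑ _ψ : P → V, c := by
        refine Finset.sum_le_sum fun ψ _ => ?_
        refine hS (fun x => if hx : x ∈ P then ψ ⟨x, hx⟩ else φ₀ x) _ (Finset.filter_subset _ _)
          fun φ hφ x hx => ?_
        rw [dif_pos hx, ← (Finset.mem_filter.1 hφ).2]
    _ = _ := by simp

/-- Resetting two coordinates of a map to their values under `ψ`. -/
noncomputable def resetPair (ψ : ι → V) (x y : ι) (φ : ι → V) : ι → V :=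
  fun z => if z = x ∨ z = y then ψ z else φ z

omit [Fintype ι] [Fintype V] in
-- A map is recovered from its values at `x`, `y` and its reset version. This splits off one pair of
-- coordinates at a time in the two inductions below.
theorem card_le_mul_card_of_resetPair {S S' : Finset (ι → V)} {D : Finset (V × V)} {ψ : ι → V}
    {x y : ι} (hS : ∀ φ ∈ S, (φ x, φ y) ∈ D ∧ resetPair ψ x y φ ∈ S') :
    S.card ≤ D.card * S'.card := by
  rw [← Finset.card_product]
  refine Finset.card_le_card_of_injOn (fun φ => ((φ x, φ y), resetPair ψ x y φ))
    (fun φ hφ => by simpa using hS φ hφ) ?_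
  intro φ _ φ' _ he
  simp only [Prod.mk.injEq] at he
  obtain ⟨⟨h1, h2⟩, h3⟩ := he
  funext z
  by_cases hz : z = x ∨ z = y
  · rcases hz with rfl | rfl <;> assumption
  · simpa [resetPair, hz] using congrFun h3 z

omit [Fintype V] in
theorem resetPair_mem_box {I : Finset ι} {C : ι → Finset V} {ψ φ : ι → V} (hφ : φ ∈ box I C ψ)
    (x y : ι) : resetPair ψ x y φ ∈ box (I \ {x, y}) C ψ := by
  rw [mem_box] at hφ ⊢
  refine ⟨fun z hz => ?_, fun z hz => ?_⟩
  · simp only [Finset.mem_sdiff, Finset.mem_insert, Finset.mem_singleton] at hz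
    simpa [resetPair, hz.2] using hφ.1 z hz.1
  · simp only [Finset.mem_sdiff, Finset.mem_insert, Finset.mem_singleton] at hz
    by_cases h : z = x ∨ z = y
    · simp [resetPair, h]
    · simpa [resetPair, h] using hφ.2 z (by tauto)

omit [Fintype ι] in
/-- Removing two indices from `I` removes few pairs. -/
theorem offDiag_subset_sdiff_pair (I : Finset ι) (x y : ι) :
    I.offDiag ⊆ (I \ {x, y}).offDiag ∪ (({x, y} : Finset ι) ×ˢ I ∪ I ×ˢ ({x, y} : Finset ι)) := by
  intro e he
  simp only [Finset.mem_offDiag, Finset.mem_union, Finset.mem_product, Finset.mem_sdiff,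
    Finset.mem_insert, Finset.mem_singleton] at he ⊢
  tauto

omit [Fintype ι] in
theorem card_pair_product_le (I : Finset ι) (x y : ι) :
    (({x, y} : Finset ι) ×ˢ I ∪ I ×ˢ ({x, y} : Finset ι)).card ≤ 4 * I.card := by
  refine (Finset.card_union_le _ _).trans ?_
  rw [Finset.card_product, Finset.card_product]
  have : ({x, y} : Finset ι).card ≤ 2 := Finset.card_le_two
  nlinarith

omit [Fintype ι] in
theorem card_sdiff_pair {I : Finset ι} {x y : ι} (hx : x ∈ I) (hy : y ∈ I) (hxy : x ≠ y) :
    (I \ {x, y}).card = I.card - 2 := by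
  rw [Finset.card_sdiff_of_subset, Finset.card_pair hxy]
  intro z hz
  simp only [Finset.mem_insert, Finset.mem_singleton] at hz
  rcases hz with rfl | rfl <;> assumption

/-- The pairs of vertices related by `r` between two cells. -/
noncomputable def relPairs (r : V → V → Prop) (C : ι → Finset V) (e : ι × ι) : Finset (V × V) :=
  (C e.1 ×ˢ C e.2).filter fun d => r d.1 d.2

omit [Fintype ι] [Fintype V] in
theorem sum_card_relPairs_eq {r : V → V → Prop} {I : Finset ι} {C : ι → Finset V}
    (hC : (I : Set ι).PairwiseDisjoint C) :
    ∑ e ∈ I.offDiag, (relPairs r C e).card = (I.offDiag.biUnion (relPairs r C)).card := by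
  rw [Finset.card_biUnion]
  intro e he e' he' hne
  refine Finset.disjoint_left.2 ?_
  rintro ⟨u, v⟩ hd hd'
  simp only [relPairs, Finset.mem_filter, Finset.mem_product] at hd hd'
  simp only [Finset.mem_coe, Finset.mem_offDiag] at he he'
  apply hne
  have key : ∀ {x y w}, x ∈ I → y ∈ I → w ∈ C x → w ∈ C y → x = y := by
    intro x y w hx hy hwx hwy
    by_contra hxy
    exact Finset.disjoint_left.1 (hC hx hy hxy) hwx hwy
  exact Prod.ext (key he.1 he'.1 hd.1.1 hd'.1.1) (key he.2.1 he'.2.1 hd.1.2 hd'.1.2)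

/-- Few transversals of disjoint cells contain many pairs of a sparse relation. -/
theorem card_box_manyPairs_le {r : V → V → Prop} {C : ι → Finset V} (ψ : ι → V) {h : ℕ}
    {b M : ℝ} (hM : 0 < M)
    (hb : (((Finset.univ : Finset (V × V)).filter fun d => r d.1 d.2).card : ℝ) ≤ b) (k : ℕ) :
    ∀ I : Finset ι, (I : Set ι).PairwiseDisjoint C → I.card ≤ h → 2 * k ≤ I.card →
      (((box I C ψ).filter fun φ =>
        M + 4 * h * k ≤ ((I.offDiag.filter fun e => r (φ e.1) (φ e.2)).card : ℝ)).card : ℝ) * M ^ k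
        ≤ b ^ k * ((Fintype.card V : ℝ) / (I.card - 2 * k : ℕ)) ^ (I.card - 2 * k) := by
  have hb0 : 0 ≤ b := le_trans (Nat.cast_nonneg _) hb
  induction k with
  | zero =>
    intro I hC _ _
    simp only [pow_zero, mul_one, one_mul, mul_zero, Nat.sub_zero]
    refine le_trans ?_ (prod_card_cells_le hC)
    rw [← Nat.cast_prod, ← card_box I C ψ]
    exact_mod_cast Finset.card_le_card (Finset.filter_subset _ _)
  | succ k ih =>
    intro I hC hIh hIk
    set T := (box I C ψ).filter fun φ =>
        M + 4 * h * (k + 1 : ℕ) ≤ ((I.offDiag.filter fun e => r (φ e.1) (φ e.2)).card : ℝ) with hT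
    set X := ((Fintype.card V : ℝ) / (I.card - 2 * (k + 1) : ℕ)) ^ (I.card - 2 * (k + 1)) with hX
    have hX0 : 0 ≤ X := by positivity
    -- Count the incidences of maps in `T` with related pairs of positions: every map in `T` has at
    -- least `M` of them.
    have h1 : (T.card : ℝ) * M ≤ ∑ e ∈ I.offDiag, ((T.filter fun φ => r (φ e.1) (φ e.2)).card : ℝ) := by
      have h2 : ∑ e ∈ I.offDiag, ((T.filter fun φ => r (φ e.1) (φ e.2)).card : ℝ) =
          ∑ φ ∈ T, ((I.offDiag.filter fun e => r (φ e.1) (φ e.2)).card : ℝ) := by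
        simp only [Finset.card_filter, Nat.cast_sum]
        exact Finset.sum_comm
      rw [h2, ← nsmul_eq_mul]
      refine Finset.card_nsmul_le_sum _ _ _ fun φ hφ => ?_
      have := (Finset.mem_filter.1 hφ).2
      have h4 : (0 : ℝ) ≤ 4 * h * (k + 1 : ℕ) := by positivity
      linarith
    have h3 : ∀ e ∈ I.offDiag, ((T.filter fun φ => r (φ e.1) (φ e.2)).card : ℝ) * M ^ k ≤
        (relPairs r C e).card * (b ^ k * X) := by
      rintro ⟨x, y⟩ he
      obtain ⟨hx, hy, hxy⟩ : x ∈ I ∧ y ∈ I ∧ x ≠ y := Finset.mem_offDiag.1 he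
      have hc := card_sdiff_pair hx hy hxy
      have h5 := ih (I \ {x, y}) (hC.subset (by simp)) (by omega) (by omega)
      rw [hc, show I.card - 2 - 2 * k = I.card - 2 * (k + 1) by omega] at h5
      have h6 : (T.filter fun φ => r (φ x) (φ y)).card ≤ (relPairs r C (x, y)).card *
          ((box (I \ {x, y}) C ψ).filter fun φ => M + 4 * h * k ≤
            (((I \ {x, y}).offDiag.filter fun e => r (φ e.1) (φ e.2)).card : ℝ)).card := by
        refine card_le_mul_card_of_resetPair (ψ := ψ) (x := x) (y := y) fun φ hφ => ?_
        rw [Finset.mem_filter, hT, Finset.mem_filter] at hφ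
        obtain ⟨⟨hφ1, hφ2⟩, hφ3⟩ := hφ
        have hφ4 := (mem_box.1 hφ1).1
        refine ⟨by simp [relPairs, hφ4 x hx, hφ4 y hy, hφ3], ?_⟩
        rw [Finset.mem_filter]
        refine ⟨resetPair_mem_box hφ1 x y, ?_⟩
        -- Deleting the coordinates `x`, `y` destroys at most `4 * h` related pairs, which is why
        -- the threshold contains `4 * h * k`.
        have h7 : (I.offDiag.filter fun e => r (φ e.1) (φ e.2)).card ≤
            ((I \ {x, y}).offDiag.filter fun e => r (resetPair ψ x y φ e.1)
              (resetPair ψ x y φ e.2)).card + 4 * I.card := by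
          refine le_trans (Finset.card_le_card ?_) ((Finset.card_union_le _ _).trans
            (Nat.add_le_add_left (card_pair_product_le I x y) _))
          intro e he
          obtain ⟨he1, he2⟩ := Finset.mem_filter.1 he
          rcases Finset.mem_union.1 (offDiag_subset_sdiff_pair I x y he1) with h8 | h8
          · refine Finset.mem_union_left _ (Finset.mem_filter.2 ⟨h8, ?_⟩)
            simp only [Finset.mem_offDiag, Finset.mem_sdiff, Finset.mem_insert,
              Finset.mem_singleton] at h8
            simpa [resetPair, h8.1.2, h8.2.1.2] using he2
          · exact Finset.mem_union_right _ h8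
        have h8 : ((I.offDiag.filter fun e => r (φ e.1) (φ e.2)).card : ℝ) ≤
            ((I \ {x, y}).offDiag.filter fun e => r (resetPair ψ x y φ e.1)
              (resetPair ψ x y φ e.2)).card + 4 * I.card := by exact_mod_cast h7
        have h9 : (I.card : ℝ) ≤ h := by exact_mod_cast hIh
        push_cast at hφ2
        linarith
      calc _ ≤ (((relPairs r C (x, y)).card * ((box (I \ {x, y}) C ψ).filter fun φ =>
            M + 4 * h * k ≤ (((I \ {x, y}).offDiag.filter fun e =>
              r (φ e.1) (φ e.2)).card : ℝ)).card : ℕ) : ℝ) * M ^ k := by gcongr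
        _ = (relPairs r C (x, y)).card * (((box (I \ {x, y}) C ψ).filter fun φ =>
            M + 4 * h * k ≤ (((I \ {x, y}).offDiag.filter fun e =>
              r (φ e.1) (φ e.2)).card : ℝ)).card * M ^ k) := by push_cast; ring
        _ ≤ _ := by gcongr
    -- The cells are disjoint, so each related pair of vertices belongs to at most one pair of
    -- positions.
    have h10 : ∑ e ∈ I.offDiag, ((relPairs r C e).card : ℝ) ≤ b := by
      refine le_trans ?_ hb
      rw [← Nat.cast_sum, sum_card_relPairs_eq hC]
      refine Nat.cast_le.2 (Finset.card_le_card fun d hd => ?_)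
      simp only [Finset.mem_biUnion, relPairs, Finset.mem_filter] at hd
      obtain ⟨e, _, _, hr⟩ := hd
      simpa using hr
    calc (T.card : ℝ) * M ^ (k + 1) = T.card * M * M ^ k := by ring
      _ ≤ (∑ e ∈ I.offDiag, ((T.filter fun φ => r (φ e.1) (φ e.2)).card : ℝ)) * M ^ k := by gcongr
      _ ≤ ∑ e ∈ I.offDiag, ((relPairs r C e).card : ℝ) * (b ^ k * X) := by
          rw [Finset.sum_mul]
          exact Finset.sum_le_sum h3
      _ = (∑ e ∈ I.offDiag, ((relPairs r C e).card : ℝ)) * (b ^ k * X) := by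
          rw [Finset.sum_mul]
      _ ≤ b * (b ^ k * X) := by gcongr
      _ = _ := by ring

omit [Fintype V] in
/-- Few transversals of disjoint cells avoid a dense relation. -/
theorem card_box_noPairs_le {r : V → V → Prop} {C : ι → Finset V} (ψ : ι → V) {h : ℕ}
    {g l : ℝ} (hl : 0 < l) (hg : 0 ≤ g) (hg1 : g ≤ 1) (k : ℕ) :
    ∀ I : Finset ι, (∀ x ∈ I, ((C x).card : ℝ) ≤ l) → I.card ≤ h → 0 < h →
      (g * h ^ 2 + 4 * h * k) * l ^ 2 ≤ ∑ e ∈ I.offDiag, ((relPairs r C e).card : ℝ) →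
      (((box I C ψ).filter fun φ => ∀ e ∈ I.offDiag, ¬ r (φ e.1) (φ e.2)).card : ℝ)
        ≤ (1 - g) ^ k * ∏ x ∈ I, ((C x).card : ℝ) := by
  induction k with
  | zero =>
    intro I _ _ _ _
    rw [pow_zero, one_mul, ← Nat.cast_prod, ← card_box I C ψ]
    exact_mod_cast Finset.card_le_card (Finset.filter_subset _ _)
  | succ k ih =>
    intro I hCl hIh hh hw
    have hh' : (0 : ℝ) < h := by exact_mod_cast hh
    have hIh' : (I.card : ℝ) ≤ h := by exact_mod_cast hIh
    have hle : ∀ e ∈ I ×ˢ I, ((relPairs r C e).card : ℝ) ≤ l ^ 2 := by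
      intro e he
      rw [Finset.mem_product] at he
      calc ((relPairs r C e).card : ℝ) ≤ ((C e.1 ×ˢ C e.2).card : ℝ) :=
            Nat.cast_le.2 (Finset.card_le_card (Finset.filter_subset _ _))
        _ = (C e.1).card * (C e.2).card := by rw [Finset.card_product]; push_cast; ring
        _ ≤ l * l := by
            have h1 := hCl _ he.1
            have h2 := hCl _ he.2
            gcongr
        _ = _ := by ring
    -- Pigeonhole over at most `h ^ 2` pairs of cells. The surplus `4 * h * k` in the hypothesis
    -- pays for the pairs lost when `x` and `y` are removed, each of weight at most `l ^ 2`.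
    obtain ⟨⟨x, y⟩, he, hge⟩ : ∃ e ∈ I.offDiag, g * l ^ 2 ≤ (relPairs r C e).card := by
      by_contra! hcon
      have h1 : ∑ e ∈ I.offDiag, ((relPairs r C e).card : ℝ) ≤ I.offDiag.card • (g * l ^ 2) :=
        Finset.sum_le_card_nsmul _ _ _ fun e he => (hcon e he).le
      have h2 : I.offDiag.card ≤ h ^ 2 := by
        rw [Finset.offDiag_card]
        nlinarith [Nat.sub_le (I.card * I.card) I.card]
      have h3 : (I.offDiag.card : ℝ) ≤ (h : ℝ) ^ 2 := by exact_mod_cast h2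
      rw [nsmul_eq_mul] at h1
      have h4 : (I.offDiag.card : ℝ) * (g * l ^ 2) ≤ (h : ℝ) ^ 2 * (g * l ^ 2) := by gcongr
      have h5 : 0 < 4 * (h : ℝ) * (k + 1 : ℕ) * l ^ 2 := by positivity
      nlinarith
    obtain ⟨hx, hy, hxy⟩ : x ∈ I ∧ y ∈ I ∧ x ≠ y := Finset.mem_offDiag.1 he
    have hw' : (g * h ^ 2 + 4 * h * k) * l ^ 2 ≤
        ∑ e ∈ (I \ {x, y}).offDiag, ((relPairs r C e).card : ℝ) := by
      have h1 : ∑ e ∈ I.offDiag, ((relPairs r C e).card : ℝ) ≤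
          ∑ e ∈ (I \ {x, y}).offDiag, ((relPairs r C e).card : ℝ) +
          ∑ e ∈ ({x, y} : Finset ι) ×ˢ I ∪ I ×ˢ ({x, y} : Finset ι),
            ((relPairs r C e).card : ℝ) := by
        refine (Finset.sum_le_sum_of_subset_of_nonneg (offDiag_subset_sdiff_pair I x y)
          fun _ _ _ => Nat.cast_nonneg _).trans ?_
        rw [← Finset.sum_union_inter]
        exact le_add_of_nonneg_right (Finset.sum_nonneg fun _ _ => Nat.cast_nonneg _)
      have h2 : ∑ e ∈ ({x, y} : Finset ι) ×ˢ I ∪ I ×ˢ ({x, y} : Finset ι),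
            ((relPairs r C e).card : ℝ) ≤
          ({x, y} ×ˢ I ∪ I ×ˢ ({x, y} : Finset ι)).card • l ^ 2 := by
        refine Finset.sum_le_card_nsmul _ _ _ fun e he => hle e ?_
        simp only [Finset.mem_union, Finset.mem_product, Finset.mem_insert,
          Finset.mem_singleton] at he ⊢
        rcases he with ⟨h1 | h1, h2⟩ | ⟨h1, h2 | h2⟩ <;> simp_all
      rw [nsmul_eq_mul] at h2
      have h3 : (({x, y} ×ˢ I ∪ I ×ˢ ({x, y} : Finset ι)).card : ℝ) ≤ 4 * h := by
        exact_mod_cast (card_pair_product_le I x y).trans (by omega)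
      have h4 : (({x, y} ×ˢ I ∪ I ×ˢ ({x, y} : Finset ι)).card : ℝ) * l ^ 2 ≤ 4 * h * l ^ 2 := by
        gcongr
      push_cast at hw
      nlinarith
    have h5 := ih (I \ {x, y}) (fun z hz => hCl z (Finset.mem_sdiff.1 hz).1)
      (by rw [card_sdiff_pair hx hy hxy]; omega) hh hw'
    have h6 : ((box I C ψ).filter fun φ => ∀ e ∈ I.offDiag, ¬ r (φ e.1) (φ e.2)).card ≤
        ((C x ×ˢ C y).filter fun d => ¬ r d.1 d.2).card *
        ((box (I \ {x, y}) C ψ).filter fun φ =>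
          ∀ e ∈ (I \ {x, y}).offDiag, ¬ r (φ e.1) (φ e.2)).card := by
      refine card_le_mul_card_of_resetPair (ψ := ψ) (x := x) (y := y) fun φ hφ => ?_
      rw [Finset.mem_filter] at hφ
      have hφ4 := (mem_box.1 hφ.1).1
      refine ⟨by simpa [hφ4 x hx, hφ4 y hy] using hφ.2 (x, y) he, ?_⟩
      rw [Finset.mem_filter]
      refine ⟨resetPair_mem_box hφ.1 x y, fun e he' => ?_⟩
      simp only [Finset.mem_offDiag, Finset.mem_sdiff, Finset.mem_insert,
        Finset.mem_singleton] at he'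
      simpa [resetPair, he'.1.2, he'.2.1.2] using
        hφ.2 e (Finset.mem_offDiag.2 ⟨he'.1.1, he'.2.1.1, he'.2.2⟩)
    -- As `|C x| * |C y| ≤ l ^ 2`, at least a fraction `g` of the pairs between the two cells is
    -- related.
    have h7 : (((C x ×ˢ C y).filter fun d => ¬ r d.1 d.2).card : ℝ) ≤
        (1 - g) * ((C x).card * (C y).card) := by
      have h8 : ((relPairs r C (x, y)).card : ℝ) + ((C x ×ˢ C y).filter fun d => ¬ r d.1 d.2).card =
          (C x).card * (C y).card := by
        have := Finset.card_filter_add_card_filter_not (s := C x ×ˢ C y) (fun d => r d.1 d.2)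
        rw [Finset.card_product] at this
        exact_mod_cast this
      have h9 : ((C x).card : ℝ) * (C y).card ≤ l * l := by
        have h1 := hCl _ hx
        have h2 := hCl _ hy
        gcongr
      nlinarith
    have h11 : ∏ z ∈ I, ((C z).card : ℝ) =
        (C x).card * (C y).card * ∏ z ∈ I \ {x, y}, ((C z).card : ℝ) := by
      rw [← Finset.prod_sdiff (s₁ := {x, y}) (s₂ := I), Finset.prod_pair hxy, mul_comm]
      intro z hz
      simp only [Finset.mem_insert, Finset.mem_singleton] at hz
      rcases hz with rfl | rfl <;> assumption
    rw [h11]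
    have hg2 : 0 ≤ 1 - g := by linarith
    calc _ ≤ ((((C x ×ˢ C y).filter fun d => ¬ r d.1 d.2).card *
        ((box (I \ {x, y}) C ψ).filter fun φ =>
          ∀ e ∈ (I \ {x, y}).offDiag, ¬ r (φ e.1) (φ e.2)).card : ℕ) : ℝ) := by
          exact_mod_cast h6
      _ = (((C x ×ˢ C y).filter fun d => ¬ r d.1 d.2).card : ℝ) *
        (((box (I \ {x, y}) C ψ).filter fun φ =>
          ∀ e ∈ (I \ {x, y}).offDiag, ¬ r (φ e.1) (φ e.2)).card : ℝ) := by push_cast; rfl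
      _ ≤ ((1 - g) * ((C x).card * (C y).card)) *
          ((1 - g) ^ k * ∏ z ∈ I \ {x, y}, ((C z).card : ℝ)) := by gcongr
      _ = _ := by ring

end Box
end

/-! ### Rigidity: self-maps of a strongly asymmetric graph with few mismatches -/

section
open scoped Classical

variable {h : ℕ} {H : SimpleGraph (Fin h)}

theorem card_filter_agree_pair_le (hH : StronglyAsymmetric H) {x y : Fin h} (hxy : x ≠ y) :
    ((Finset.univ.filter fun z => z ≠ x ∧ z ≠ y ∧ (H.Adj z x ↔ H.Adj z y)).card : ℝ) ≤
      (55 / 100 : ℝ) * h := by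
  have h1 := hH.agreement_pair {x, y} (Set.ncard_pair hxy)
  refine le_trans ?_ h1
  rw [← Set.ncard_coe_finset]
  refine Nat.cast_le.2 (Set.ncard_le_ncard ?_ (Set.toFinite _))
  intro z hz
  simp only [Finset.coe_filter, Finset.mem_univ, true_and, Set.mem_ofPred_eq] at hz
  simp only [agreementSet, Set.mem_ofPred_eq, Set.mem_insert_iff, Set.mem_singleton_iff,
    forall_eq_or_imp, forall_eq]
  tauto

theorem card_filter_agree_triple_le (hH : StronglyAsymmetric H) {x y w : Fin h} (hxy : x ≠ y)
    (hxw : x ≠ w) (hyw : y ≠ w) :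
    ((Finset.univ.filter fun z => (z ≠ x ∧ z ≠ y ∧ z ≠ w) ∧
      (H.Adj x z ↔ H.Adj y z) ∧ (H.Adj y z ↔ H.Adj w z)).card : ℝ) ≤ (3 / 10 : ℝ) * h := by
  have h1 := hH.agreement_triple {x, y, w} (Set.ncard_eq_three.2 ⟨x, y, w, hxy, hxw, hyw, rfl⟩)
  refine le_trans ?_ h1
  rw [← Set.ncard_coe_finset]
  refine Nat.cast_le.2 (Set.ncard_le_ncard ?_ (Set.toFinite _))
  intro z hz
  simp only [Finset.coe_filter, Finset.mem_univ, true_and, Set.mem_ofPred_eq] at hz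
  simp only [agreementSet, Set.mem_ofPred_eq, Set.mem_insert_iff, Set.mem_singleton_iff,
    forall_eq_or_imp, forall_eq, H.adj_comm z]
  tauto

/-- Converts a bound on ordered mismatches into the bound on changed unordered pairs that
`blowup_far` and `iso_far` speak of. -/
theorem ncard_symmDiff_edgeSet_le {W : Type*} [Finite W] (A B : SimpleGraph W) (P : Sym2 W → Prop)
    {f : W → Fin h} (hf : Function.Injective f) (T : Finset (Fin h × Fin h))
    (hT : ∀ u v, P s(u, v) → ¬ (A.Adj u v ↔ B.Adj u v) → (f u, f v) ∈ T) :
    {e ∈ symmDiff A.edgeSet B.edgeSet | P e}.ncard ≤ T.card := by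
  refine le_trans ?_ (Finset.card_image_le (s := T) (f := fun e : Fin h × Fin h => s(e.1, e.2)))
  rw [← Set.ncard_coe_finset]
  refine Set.ncard_le_ncard_of_injOn (Sym2.map f) ?_ ((Sym2.map.injective hf).injOn)
    (Set.toFinite _)
  intro e
  induction e using Sym2.ind with
  | _ u v =>
    rintro ⟨he, hP⟩
    have h1 : ¬ (A.Adj u v ↔ B.Adj u v) := by
      rw [Set.mem_symmDiff, SimpleGraph.mem_edgeSet, SimpleGraph.mem_edgeSet] at he
      tauto
    simp only [Finset.coe_image, Set.mem_image, Finset.mem_coe]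
    exact ⟨_, hT u v hP h1, by simp⟩

/-- The ordered pairs of vertices at which a map `σ`, assigning to each vertex a part of a blowup of
`H`, is inconsistent with the adjacencies of `H`. -/
noncomputable def mismatches (H : SimpleGraph (Fin h)) (σ : Fin h → Fin h) :
    Finset (Fin h × Fin h) :=
  Finset.univ.filter fun e => σ e.1 ≠ σ e.2 ∧ ¬ (H.Adj e.1 e.2 ↔ H.Adj (σ e.1) (σ e.2))

theorem mem_mismatches {σ : Fin h → Fin h} {x y : Fin h} : (x, y) ∈ mismatches H σ ↔
    σ x ≠ σ y ∧ ¬ (H.Adj x y ↔ H.Adj (σ x) (σ y)) := by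
  simp [mismatches]

/-- If `σ` has a large image and few mismatches then it fixes many vertices. -/
theorem card_fixed_of_large_image (hH : StronglyAsymmetric H) {σ : Fin h → Fin h}
    (hmis : ((mismatches H σ).card : ℝ) ≤ (h : ℝ) ^ 2 / 10 ^ 5)
    (him : ⌈(7 / 10 : ℝ) * h⌉₊ ≤ (Finset.univ.image σ).card) :
    (6 / 10 : ℝ) * h ≤ ((Finset.univ.filter fun x => σ x = x).card : ℝ) := by
  obtain ⟨K, hK, hKc⟩ := Finset.exists_subset_card_eq him
  have hsurj : Set.SurjOn σ Set.univ (K : Set (Fin h)) := by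
    intro i hi
    simpa using hK hi
  -- `J` is a section of `σ` over `K`. Since `σ` is injective on `J`, every disagreement between
  -- `H[J]` and the pullback of `H[K]` is a mismatch.
  obtain ⟨J, -, hJ⟩ := hsurj.exists_bijOn_subset
  have hJc : J.ncard = ⌈(7 / 10 : ℝ) * h⌉₊ := by
    rw [← hKc, ← Set.ncard_coe_finset K, ← hJ.image_eq, hJ.injOn.ncard_image]
  have hKc' : (K : Set (Fin h)).ncard = ⌈(7 / 10 : ℝ) * h⌉₊ := by
    rw [Set.ncard_coe_finset, hKc]
  have hfar := hH.iso_far J K (Set.BijOn.equiv σ hJ) hJc hKc'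
  have hclose : CloseToIso (H.induce J) (H.induce (K : Set (Fin h))) (Set.BijOn.equiv σ hJ)
      ((h : ℝ) ^ 2 / 10 ^ 5) := by
    refine ⟨(H.induce (K : Set (Fin h))).comap (Set.BijOn.equiv σ hJ), le_trans ?_ hmis,
      fun u v => Iff.rfl⟩
    have := ncard_symmDiff_edgeSet_le (H.induce J)
      ((H.induce (K : Set (Fin h))).comap (Set.BijOn.equiv σ hJ)) (fun e => ¬ e.IsDiag)
      Subtype.val_injective (mismatches H σ) (by
        intro u v hd hne
        rw [mem_mismatches]
        refine ⟨fun heq => hd ?_, hne⟩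
        rw [Sym2.mk_isDiag_iff]
        exact Subtype.ext (hJ.injOn u.2 v.2 heq))
    refine Nat.cast_le.2 (le_trans (le_of_eq ?_) this)
    congr 1
    ext e
    simp only [Set.mem_ofPred_eq, iff_self_and]
    intro he
    rcases he with ⟨he, _⟩ | ⟨he, _⟩ <;> exact SimpleGraph.not_isDiag_of_mem_edgeSet _ he
  -- By `iso_far`, fewer than `0.1 * h` of the at least `0.7 * h` points of `J` are moved.
  have hlt := not_le.1 fun hle => hfar hle hclose
  have h1 : J.ncard ≤ {x : J | ((Set.BijOn.equiv σ hJ x : (K : Set (Fin h))) : Fin h) ≠ x}.ncard +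
      (Finset.univ.filter fun x => σ x = x).card := by
    have h2 : {x : J | ((Set.BijOn.equiv σ hJ x : (K : Set (Fin h))) : Fin h) ≠ x}.ncard =
        (J ∩ {x | σ x ≠ x}).ncard := by
      rw [← Set.ncard_image_of_injective _ Subtype.val_injective]
      congr 1
      ext x
      simp [Set.BijOn.equiv, and_comm]
    rw [h2, ← Set.ncard_coe_finset]
    refine le_trans (Set.ncard_le_ncard ?_ (Set.toFinite _)) (Set.ncard_union_le _ _)
    intro x hx
    by_cases hσ : σ x = x
    · right; simpa using hσ
    · left; exact ⟨hx, hσ⟩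
  have h2 : (7 / 10 : ℝ) * h ≤ J.ncard := hJc ▸ Nat.le_ceil _
  have h3 : (J.ncard : ℝ) ≤ _ := Nat.cast_le.2 h1
  push_cast at h3
  linarith

/-- If `σ` has few mismatches and fixes many vertices, it fixes almost all vertices. -/
theorem card_not_fixed_of_card_fixed (hH : StronglyAsymmetric H) {σ : Fin h → Fin h}
    (hh : 1000 ≤ h) {μ : ℝ} (hmis : ((mismatches H σ).card : ℝ) ≤ μ * (h : ℝ) ^ 2)
    (hfix : (6 / 10 : ℝ) * h ≤ ((Finset.univ.filter fun x => σ x = x).card : ℝ)) :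
    ((Finset.univ.filter fun x => σ x ≠ x).card : ℝ) ≤ 25 * μ * h := by
  have hh' : (1000 : ℝ) ≤ h := by exact_mod_cast hh
  -- At most `0.55 * h` vertices fail to distinguish `y` from `σ y`, so at least `0.6 * h - 0.55 * h
  -- - 1 ≥ 0.04 * h` fixed vertices form a mismatch with `y`. The constant 25 is `1 / 0.04`.
  have h1 : ∀ y ∈ Finset.univ.filter fun x => σ x ≠ x, (4 / 100 : ℝ) * h ≤
      (((mismatches H σ).filter fun e => e.1 = y).card : ℝ) := by
    intro y hy
    have hy' : σ y ≠ y := by simpa using hy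
    have h2 : (Finset.univ.filter fun x => σ x = x) ⊆
        (Finset.univ.filter fun z => z ≠ y ∧ z ≠ σ y ∧ (H.Adj z y ↔ H.Adj z (σ y))) ∪
        ({σ y} ∪ (((mismatches H σ).filter fun e => e.1 = y).image Prod.snd)) := by
      intro z hz
      have hz' : σ z = z := by simpa using hz
      by_cases h3 : z = σ y
      · simp [h3]
      have h4 : z ≠ y := by
        rintro rfl
        exact hy' hz'
      by_cases h5 : H.Adj z y ↔ H.Adj z (σ y)
      · simp [h3, h4, h5]
      · refine Finset.mem_union_right _ (Finset.mem_union_right _ (Finset.mem_image.2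
          ⟨(y, z), Finset.mem_filter.2 ⟨?_, rfl⟩, rfl⟩))
        rw [mem_mismatches, hz', H.adj_comm y z, H.adj_comm (σ y) z]
        exact ⟨Ne.symm h3, h5⟩
    have h3 := (Finset.card_le_card h2).trans ((Finset.card_union_le _ _).trans
      (Nat.add_le_add_left (Finset.card_union_le _ _) _))
    have h4 : (((mismatches H σ).filter fun e => e.1 = y).image Prod.snd).card ≤
      ((mismatches H σ).filter fun e => e.1 = y).card := Finset.card_image_le
    have h5 := card_filter_agree_pair_le hH (Ne.symm hy')
    rw [Finset.card_singleton] at h3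
    have h6 : ((Finset.univ.filter fun x => σ x = x).card : ℝ) ≤
      (Finset.univ.filter fun z => z ≠ y ∧ z ≠ σ y ∧ (H.Adj z y ↔ H.Adj z (σ y))).card +
      (1 + ((mismatches H σ).filter fun e => e.1 = y).card) := by
      rw [← Nat.cast_one, ← Nat.cast_add, ← Nat.cast_add]
      exact Nat.cast_le.2 (h3.trans (by omega))
    linarith
  have h2 := Finset.card_nsmul_le_sum _ _ _ h1
  have h3 : ∑ y ∈ Finset.univ.filter fun x => σ x ≠ x,
      (((mismatches H σ).filter fun e => e.1 = y).card : ℝ) ≤ (mismatches H σ).card := by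
    rw [← Nat.cast_sum]
    rw [Finset.sum_card_fiberwise_eq_card_filter]
    exact Nat.cast_le.2 (Finset.card_filter_le _ _)
  rw [nsmul_eq_mul] at h2
  have h4 : (((Finset.univ.filter fun x => σ x ≠ x).card : ℝ) * (4 / 100)) * h ≤ (μ * h) * h := by
    nlinarith
  have h5 := le_of_mul_le_mul_right h4 (by linarith)
  linarith

/-- If `σ` has few mismatches and a small image, some fibre of `σ` is not small. -/
theorem exists_fiber_of_small_image (hH : StronglyAsymmetric H) {σ : Fin h → Fin h} (hh : 0 < h)
    (hmis : ((mismatches H σ).card : ℝ) ≤ (h : ℝ) ^ 2 / 10 ^ 5)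
    (him : ((Finset.univ.image σ).card : ℝ) ≤ (7 / 10 : ℝ) * h) :
    ∃ i, (h : ℝ) / 100 < ((Finset.univ.filter fun x => σ x = i).card : ℝ) := by
  by_contra! hsmall
  set S : Set (Fin h) := Set.range σ with hS
  let f : Fin h → S := Set.rangeFactorization σ
  let a : S → ℕ := fun i => Nat.card {x // f x = i}
  let K : Set (Fin h) := Set.univ
  -- The parts of the blowup of `H[S]` are the fibres of `σ`, and the changed graph is `H` itself.
  -- The changes between different parts are then mismatches, contradicting `blowup_far` if all
  -- fibres are small.
  let e : (Σ i : S, Fin (a i)) ≃ K :=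
    ((Equiv.sigmaCongrRight fun i => (Finite.equivFin {x // f x = i}).symm).trans
      (Equiv.sigmaFiberEquiv f)).trans (Equiv.Set.univ _).symm
  have he : ∀ u, σ (e u) = u.1 := by
    rintro ⟨i, j⟩
    exact congrArg Subtype.val ((Finite.equivFin {x // f x = i}).symm j).2
  have hcard : Nat.card (Σ i : S, Fin (a i)) = h := by
    rw [Nat.card_congr e, Nat.card_congr (Equiv.Set.univ _), Nat.card_eq_fintype_card,
      Fintype.card_fin]
  have hSc : S.ncard = (Finset.univ.image σ).card := by
    rw [← Set.ncard_coe_finset]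
    simp [hS]
  have hac : ∀ i : S, a i = (Finset.univ.filter fun x => σ x = i).card := by
    intro i
    rw [← Fintype.card_subtype, ← Nat.card_eq_fintype_card]
    refine Nat.card_congr (Equiv.subtypeEquivRight fun x => ?_)
    exact Subtype.ext_iff
  have hh' : (0 : ℝ) < h := by exact_mod_cast hh
  refine hH.blowup_far S K a (by rw [hSc]; exact him) ?_ (by rw [hcard]; linarith) hcard.le
    ⟨(H.induce K).comap e, le_trans ?_ hmis, ⟨SimpleGraph.Iso.comap e _⟩⟩
  · intro i
    obtain ⟨x, hx⟩ := i.2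
    refine ⟨?_, by rw [hac]; exact hsmall _⟩
    rw [hac, Nat.one_le_iff_ne_zero, Finset.card_ne_zero]
    exact ⟨x, by simpa using hx⟩
  · refine Nat.cast_le.2 (ncard_symmDiff_edgeSet_le _ _ _
      (Subtype.val_injective.comp e.injective) _ ?_)
    intro u v hd hne
    rw [Sym2.map_mk, Sym2.mk_isDiag_iff] at hd
    rw [Function.comp_apply, Function.comp_apply, mem_mismatches, he, he]
    refine ⟨fun h1 => hd (Subtype.ext h1), fun h1 => hne ?_⟩
    simpa [blowup] using h1.symm

/-- If `σ` has few mismatches, a fibre that is not small is very large. -/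
theorem card_fiber_of_not_small (hH : StronglyAsymmetric H) {σ : Fin h → Fin h} (hh : 1000 ≤ h)
    (hmis : ((mismatches H σ).card : ℝ) ≤ (h : ℝ) ^ 2 / 10 ^ 6) {i : Fin h}
    (hi : (h : ℝ) / 100 < ((Finset.univ.filter fun x => σ x = i).card : ℝ)) :
    (69 / 100 : ℝ) * h ≤ ((Finset.univ.filter fun x => σ x = i).card : ℝ) := by
  have hh' : (1000 : ℝ) ≤ h := by exact_mod_cast hh
  set F := Finset.univ.filter fun x => σ x = i with hF
  let B : Fin h → Finset (Fin h) := fun x =>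
    Finset.univ.filter fun y => σ y ≠ i ∧ ¬ (H.Adj x y ↔ H.Adj i (σ y))
  have hsum : ∑ x ∈ F, ((B x).card : ℝ) ≤ (h : ℝ) ^ 2 / 10 ^ 6 := by
    refine le_trans ?_ hmis
    rw [← Nat.cast_sum, ← Finset.card_sigma]
    refine Nat.cast_le.2 (Finset.card_le_card_of_injOn (fun d => (d.1, d.2)) ?_ ?_)
    · rintro ⟨x, y⟩ hd
      simp only [hF, Finset.coe_sigma, Set.mem_sigma_iff, Finset.mem_coe, Finset.mem_filter,
        Finset.mem_univ, true_and, B] at hd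
      simp only [Finset.mem_coe, mem_mismatches, hd.1]
      exact ⟨Ne.symm hd.2.1, hd.2.2⟩
    · rintro ⟨x, y⟩ _ ⟨x', y'⟩ _ he
      simp only [Prod.mk.injEq] at he
      obtain ⟨rfl, rfl⟩ := he
      rfl
  -- At most `h / 1000` points of the fibre have a large `B x`, while the fibre has more than `h /
  -- 100` points.
  have hlight : 2 < (F.filter fun x => ((B x).card : ℝ) ≤ (h : ℝ) / 1000).card := by
    have h1 : ((F.filter fun x => ¬ ((B x).card : ℝ) ≤ (h : ℝ) / 1000).card : ℝ) * (h / 1000) ≤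
        (h : ℝ) ^ 2 / 10 ^ 6 := by
      refine le_trans ?_ hsum
      rw [← nsmul_eq_mul]
      refine (Finset.card_nsmul_le_sum _ (fun x => ((B x).card : ℝ)) _ ?_).trans
        (Finset.sum_le_sum_of_subset_of_nonneg (Finset.filter_subset _ _)
          fun _ _ _ => Nat.cast_nonneg _)
      intro x hx
      exact (not_le.1 (Finset.mem_filter.1 hx).2).le
    have h2 : ((F.filter fun x => ¬ ((B x).card : ℝ) ≤ (h : ℝ) / 1000).card : ℝ) ≤ h / 1000 := by
      refine le_of_mul_le_mul_right (h1.trans (le_of_eq ?_)) (by linarith : (0 : ℝ) < h / 1000)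
      ring
    have h3 : ((F.filter fun x => ((B x).card : ℝ) ≤ (h : ℝ) / 1000).card : ℝ) +
        (F.filter fun x => ¬ ((B x).card : ℝ) ≤ (h : ℝ) / 1000).card = F.card := by
      exact_mod_cast Finset.card_filter_add_card_filter_not _
    have h4 : (2 : ℝ) < (F.filter fun x => ((B x).card : ℝ) ≤ (h : ℝ) / 1000).card := by linarith
    exact_mod_cast h4
  obtain ⟨x, y, w, hx, hy, hw, hxy, hxw, hyw⟩ := Finset.two_lt_card_iff.1 hlight
  have hagree := card_filter_agree_triple_le hH hxy hxw hyw
  rw [Finset.mem_filter] at hx hy hw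
  -- Outside `F` and the three sets `B`, the vertices `x`, `y`, `w` all behave like `i`, so they
  -- agree with each other. The triple condition gives `|F| ≥ h - 0.3 * h - 3 * h / 1000`.
  have hcover : (Finset.univ : Finset (Fin h)) ⊆ F ∪ ((Finset.univ.filter fun z =>
      (z ≠ x ∧ z ≠ y ∧ z ≠ w) ∧ (H.Adj x z ↔ H.Adj y z) ∧ (H.Adj y z ↔ H.Adj w z)) ∪
      (B x ∪ (B y ∪ B w))) := by
    intro z _
    by_cases hz : σ z = i
    · simp [hF, hz]
    have hne : ∀ x' ∈ F, z ≠ x' := by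
      rintro x' hx' rfl
      exact hz (by simpa [hF] using hx')
    have h1 := hne x hx.1
    have h2 := hne y hy.1
    have h3 := hne w hw.1
    simp only [Finset.mem_union, Finset.mem_filter, Finset.mem_univ, true_and, B]
    tauto
  have h1 := (Finset.card_le_card hcover).trans ((Finset.card_union_le _ _).trans
    (Nat.add_le_add_left ((Finset.card_union_le _ _).trans (Nat.add_le_add_left
    ((Finset.card_union_le _ _).trans (Nat.add_le_add_left (Finset.card_union_le _ _) _)) _)) _))
  rw [Finset.card_univ, Fintype.card_fin] at h1
  have h2 : (h : ℝ) ≤ _ := Nat.cast_le.2 h1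
  push_cast at h2
  linarith [hx.2, hy.2, hw.2]

/-- A map with few mismatches is close to the identity or close to constant. -/
theorem near_id_or_large_fiber (hH : StronglyAsymmetric H) (hh : 1000 ≤ h) (σ : Fin h → Fin h)
    {μ : ℝ} (hμ : μ ≤ 1 / 10 ^ 6) (hmis : ((mismatches H σ).card : ℝ) ≤ μ * (h : ℝ) ^ 2) :
    ((Finset.univ.filter fun x => σ x ≠ x).card : ℝ) ≤ 25 * μ * h ∨
      ∃ i, (69 / 100 : ℝ) * h ≤ ((Finset.univ.filter fun x => σ x = i).card : ℝ) := by
  have h6 : ((mismatches H σ).card : ℝ) ≤ (h : ℝ) ^ 2 / 10 ^ 6 := by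
    nlinarith [sq_nonneg (h : ℝ)]
  have h5 : ((mismatches H σ).card : ℝ) ≤ (h : ℝ) ^ 2 / 10 ^ 5 := by
    nlinarith [sq_nonneg (h : ℝ)]
  by_cases him : ⌈(7 / 10 : ℝ) * h⌉₊ ≤ (Finset.univ.image σ).card
  · exact Or.inl (card_not_fixed_of_card_fixed hH hh hmis (card_fixed_of_large_image hH h5 him))
  · obtain ⟨i, hi⟩ := exists_fiber_of_small_image hH (by omega) h5
      (Nat.lt_ceil.1 (not_le.1 him)).le
    exact Or.inr ⟨i, card_fiber_of_not_small hH hh h6 hi⟩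

end

/-! ### Adjacency-preserving maps and the partition they force -/

section
open scoped Classical

variable {h : ℕ} {V : Type*} [Fintype V]

/-- The maps from the vertices of `H` to the vertices of `G` preserving adjacency and
nonadjacency. -/
noncomputable def adjMaps (H : SimpleGraph (Fin h)) (G : SimpleGraph V) : Finset (Fin h → V) :=
  Finset.univ.filter fun φ => ∀ x y, H.Adj x y ↔ G.Adj (φ x) (φ y)

/-- The possible images of `x` under an element of `adjMaps H G` that agrees with `ψ` on `Q`. -/
noncomputable def cell (H : SimpleGraph (Fin h)) (G : SimpleGraph V) (Q : Finset (Fin h))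
    (ψ : Fin h → V) (x : Fin h) : Finset V :=
  Finset.univ.filter fun w => ∀ s ∈ Q, H.Adj x s ↔ G.Adj w (ψ s)

/-- The pair `u`, `v` is inconsistent with the blowup of `H` with parts given by `p`. -/
def Bad {V : Type*} (H : SimpleGraph (Fin h)) (G : SimpleGraph V) (p : V → Fin h) (u v : V) :
    Prop :=
  p u ≠ p v ∧ ¬ (G.Adj u v ↔ H.Adj (p u) (p v))

variable {H : SimpleGraph (Fin h)} {G : SimpleGraph V} {Q P : Finset (Fin h)}

theorem mem_adjMaps {φ : Fin h → V} :
    φ ∈ adjMaps H G ↔ ∀ x y, H.Adj x y ↔ G.Adj (φ x) (φ y) := by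
  simp [adjMaps]

/-- A vertex in two cells would give both indices the same adjacencies to `Q`. The set `P` leaves
room for fixing further positions besides `Q`. -/
theorem pairwiseDisjoint_cell (hQ : IsDistinguishing H (Q : Set (Fin h))) (hP : Q ⊆ P)
    (ψ : Fin h → V) : ((Pᶜ : Finset (Fin h)) : Set (Fin h)).PairwiseDisjoint (cell H G Q ψ) := by
  intro x hx y hy hxy
  refine Finset.disjoint_left.2 fun w hwx hwy => ?_
  have hx' : x ∉ Q := fun hxQ => by simp [hP hxQ] at hx
  have hy' : y ∉ Q := fun hyQ => by simp [hP hyQ] at hy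
  simp only [cell, Finset.mem_filter, Finset.mem_univ, true_and] at hwx hwy
  refine hQ x y (by simpa using hx') (by simpa using hy') hxy fun s hs => ?_
  have hsQ : s ∈ Q := by simpa using hs
  have h1 := hwx s hsQ
  have h2 := hwy s hsQ
  have h3 : s ≠ x := fun h => hx' (h ▸ hsQ)
  have h4 : s ≠ y := fun h => hy' (h ▸ hsQ)
  simp only [agreementSet, Set.mem_ofPred_eq, Set.mem_insert_iff, Set.mem_singleton_iff,
    forall_eq_or_imp, forall_eq, H.adj_comm s]
  tauto

theorem mem_box_of_mem_adjMaps (hP : Q ⊆ P) {φ ψ : Fin h → V} (hφ : φ ∈ adjMaps H G)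
    (hψ : ∀ x ∈ P, φ x = ψ x) : φ ∈ box Pᶜ (cell H G Q ψ) ψ := by
  rw [mem_box]
  refine ⟨fun x _ => ?_, fun x hx => hψ x (by simpa using hx)⟩
  simp only [cell, Finset.mem_filter, Finset.mem_univ, true_and]
  intro s hs
  rw [← hψ s (hP hs)]
  exact mem_adjMaps.1 hφ x s

/-- The bridge between the two kinds of error: `G` against a blowup of `H`, and the composite map
against `H`. -/
theorem mem_mismatches_comp {φ : Fin h → V} (hφ : φ ∈ adjMaps H G) (p : V → Fin h)
    {x y : Fin h} : (x, y) ∈ mismatches H (p ∘ φ) ↔ Bad H G p (φ x) (φ y) := by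
  rw [mem_mismatches, Bad, mem_adjMaps.1 hφ x y]
  rfl

/-- Few maps have many bad pairs. -/
theorem card_manyMismatches_le (hQ : IsDistinguishing H (Q : Set (Fin h))) (hP : Q ⊆ P)
    (p : V → Fin h) {b M : ℝ} (hM : 0 < M)
    (hb : (((Finset.univ : Finset (V × V)).filter fun d => Bad H G p d.1 d.2).card : ℝ) ≤ b)
    {k : ℕ} (hk : 2 * k + P.card ≤ h) (ψ : Fin h → V) :
    (((adjMaps H G).filter fun φ => (∀ x ∈ P, φ x = ψ x) ∧
      M + 4 * h * k + 2 * h * P.card ≤ ((mismatches H (p ∘ φ)).card : ℝ)).card : ℝ) * M ^ k ≤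
      b ^ k * ((Fintype.card V : ℝ) / (h - P.card - 2 * k : ℕ)) ^ (h - P.card - 2 * k) := by
  have hc : (Pᶜ : Finset (Fin h)).card = h - P.card := by
    rw [Finset.card_compl, Fintype.card_fin]
  have key := card_box_manyPairs_le (r := Bad H G p) (h := h) ψ hM hb k Pᶜ
    (pairwiseDisjoint_cell (G := G) hQ hP ψ) (by omega) (by omega)
  rw [hc] at key
  refine le_trans ?_ key
  gcongr
  intro φ hφ
  rw [Finset.mem_filter] at hφ ⊢
  obtain ⟨hφE, hφψ, hmis⟩ := hφ
  refine ⟨mem_box_of_mem_adjMaps hP hφE hφψ, ?_⟩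
  -- Pairs meeting `P` escape the count of transversals; they account for the term `2 * h * P.card`
  -- in the threshold.
  have h1 : mismatches H (p ∘ φ) ⊆ ((Pᶜ : Finset (Fin h)).offDiag.filter fun e =>
      Bad H G p (φ e.1) (φ e.2)) ∪ (P ×ˢ Finset.univ ∪ Finset.univ ×ˢ P) := by
    rintro ⟨x, y⟩ he
    have hne : x ≠ y := by
      rintro rfl
      exact (mem_mismatches.1 he).1 rfl
    rw [mem_mismatches_comp hφE] at he
    simp only [Finset.mem_union, Finset.mem_filter, Finset.mem_offDiag, Finset.mem_compl,
      Finset.mem_product, Finset.mem_univ, and_true, true_and]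
    tauto
  have h2 := (Finset.card_le_card h1).trans ((Finset.card_union_le _ _).trans
    (Nat.add_le_add_left (Finset.card_union_le _ _) _))
  rw [Finset.card_product, Finset.card_product, Finset.card_univ, Fintype.card_fin] at h2
  have h3 : ((mismatches H (p ∘ φ)).card : ℝ) ≤ _ := Nat.cast_le.2 h2
  push_cast at h3
  linarith

/-- Few maps send many vertices of `H` to the same part, if all parts are small. -/
theorem card_largeFiber_le (hQ : IsDistinguishing H (Q : Set (Fin h))) (hP : Q ⊆ P)
    {p : V → Fin h} {α : ℝ} (hα : 0 < α) (hα1 : α ≤ 1)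
    (hp : ∀ i, ((Finset.univ.filter fun v => p v = i).card : ℝ) ≤ α * Fintype.card V)
    (f : ℕ) (ψ : Fin h → V) :
    (((adjMaps H G).filter fun φ => (∀ x ∈ P, φ x = ψ x) ∧
      ∃ i, f + P.card ≤ (Finset.univ.filter fun x => p (φ x) = i).card).card : ℝ) ≤
      (h * 2 ^ h) * (α ^ f * (2 * Fintype.card V / (h - P.card : ℕ)) ^ (h - P.card)) := by
  have hc : (Pᶜ : Finset (Fin h)).card = h - P.card := by
    rw [Finset.card_compl, Fintype.card_fin]
  -- Union bound over the part and the set of free positions sent to it; at those positions the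
  -- cells shrink to a set of density `α`.
  let T : Finset (Fin h × Finset (Fin h)) :=
    Finset.univ ×ˢ ((Pᶜ : Finset (Fin h)).powerset.filter fun F => f ≤ F.card)
  have hT : (T.card : ℝ) ≤ h * 2 ^ h := by
    have : T.card ≤ h * 2 ^ h := by
      rw [Finset.card_product, Finset.card_univ, Fintype.card_fin]
      refine Nat.mul_le_mul_left _ ((Finset.card_filter_le _ _).trans ?_)
      rw [Finset.card_powerset]
      exact Nat.pow_le_pow_right (by norm_num) (by omega)
    exact_mod_cast this
  let B : Fin h × Finset (Fin h) → Finset (Fin h → V) := fun t =>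
    box Pᶜ (fun x => if x ∈ t.2 then cell H G Q ψ x ∩ (Finset.univ.filter fun v => p v = t.1)
      else cell H G Q ψ x) ψ
  have hsub : ((adjMaps H G).filter fun φ => (∀ x ∈ P, φ x = ψ x) ∧
      ∃ i, f + P.card ≤ (Finset.univ.filter fun x => p (φ x) = i).card) ⊆ T.biUnion B := by
    intro φ hφ
    obtain ⟨hφE, hφψ, i, hi⟩ := Finset.mem_filter.1 hφ
    have hbox := mem_box.1 (mem_box_of_mem_adjMaps hP hφE hφψ)
    rw [Finset.mem_biUnion]
    refine ⟨(i, (Pᶜ : Finset (Fin h)).filter fun x => p (φ x) = i), ?_, ?_⟩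
    · simp only [T, Finset.mem_product, Finset.mem_univ, true_and, Finset.mem_filter,
        Finset.mem_powerset, Finset.filter_subset]
      have h1 : (Finset.univ.filter fun x => p (φ x) = i) ⊆
          ((Pᶜ : Finset (Fin h)).filter fun x => p (φ x) = i) ∪ P := by
        intro x hx
        by_cases hxP : x ∈ P
        · simp [hxP]
        · simpa [hxP] using hx
      have h2 := (Finset.card_le_card h1).trans (Finset.card_union_le _ _)
      omega
    · refine mem_box.2 ⟨fun x hx => ?_, hbox.2⟩
      have := hbox.1 x hx
      split_ifs with hx'
      · simpa [this] using (Finset.mem_filter.1 hx').2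
      · exact this
  have hB : ∀ t ∈ T, ((B t).card : ℝ) ≤
      α ^ f * (2 * Fintype.card V / (h - P.card : ℕ)) ^ (h - P.card) := by
    intro t ht
    simp only [T, Finset.mem_product, Finset.mem_univ, true_and, Finset.mem_filter,
        Finset.mem_powerset] at ht
    have h1 := prod_card_cells_inter_le (pairwiseDisjoint_cell (G := G) hQ hP ψ) ht.1 hα (hp t.1)
    rw [hc] at h1
    rw [card_box, Nat.cast_prod]
    refine h1.trans ?_
    exact mul_le_mul_of_nonneg_right (pow_le_pow_of_le_one hα.le hα1 ht.2) (by positivity)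
  calc _ ≤ ((T.biUnion B).card : ℝ) := Nat.cast_le.2 (Finset.card_le_card hsub)
    _ ≤ ∑ t ∈ T, ((B t).card : ℝ) := by exact_mod_cast Finset.card_biUnion_le
    _ ≤ T.card • (α ^ f * (2 * Fintype.card V / (h - P.card : ℕ)) ^ (h - P.card)) :=
        Finset.sum_le_card_nsmul _ _ _ hB
    _ ≤ _ := by
        rw [nsmul_eq_mul]
        gcongr

set_option maxHeartbeats 400000 in
/-- If `G` has many copies of `H`, then it is close to a blowup of `H`. -/
theorem exists_partition (hQ : IsDistinguishing H (Q : Set (Fin h))) (hQh : Q.card < h)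
    (hE : (Fintype.card V : ℝ) ^ h / (h : ℝ) ^ h < (adjMaps H G).card)
    {l g : ℝ} (hl : 0 < l) (hl1 : l ≤ 1) (hg : 0 ≤ g) (hg1 : g ≤ 1) {k : ℕ}
    (hll : (1 - l) ^ (h - Q.card - 1) * (Real.exp 1 * h) ^ (Q.card + 1) < 1)
    (hgk : (1 - g) ^ k * (Real.exp 1 * h) ^ Q.card < 1) :
    ∃ p : V → Fin h,
      (∀ i, ((Finset.univ.filter fun v => p v = i).card : ℝ) ≤ 2 * l * Fintype.card V) ∧
      (((Finset.univ : Finset (V × V)).filter fun d => Bad H G p d.1 d.2).card : ℝ) ≤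
        ((g * h ^ 2 + 4 * h * k) * l ^ 2 + 2 * l) * (Fintype.card V : ℝ) ^ 2 := by
  have hh : 0 < h := by omega
  have hh' : (0 : ℝ) < h := by exact_mod_cast hh
  set n : ℝ := (Fintype.card V : ℝ) with hn
  have hn0 : 0 ≤ n := Nat.cast_nonneg _
  have he1 : 1 ≤ Real.exp 1 * h := by
    have h1 : (1 : ℝ) ≤ h := by exact_mod_cast hh
    nlinarith [Real.add_one_le_exp (1 : ℝ)]
  set c : ℝ := n ^ (h - Q.card) / (h : ℝ) ^ h with hc
  have hc0 : 0 ≤ c := by positivity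
  -- Averaging over the `n ^ |Q|` restrictions to `Q`.
  obtain ⟨ψ, hψ⟩ : ∃ ψ : Fin h → V,
      c < ((adjMaps H G).filter fun φ => ∀ x ∈ Q, φ x = ψ x).card := by
    by_contra! hcon
    have h1 := card_le_pow_mul (adjMaps H G) Q hc0 fun ψ S' hS' hψ =>
      (Nat.cast_le.2 (Finset.card_le_card fun φ hφ =>
        Finset.mem_filter.2 ⟨hS' hφ, hψ φ hφ⟩)).trans (hcon ψ)
    rw [← hn, hc, ← mul_div_assoc, ← pow_add, Nat.add_sub_cancel' hQh.le] at h1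
    linarith
  set I : Finset (Fin h) := Qᶜ with hI
  have hIc : I.card = h - Q.card := by rw [hI, Finset.card_compl, Fintype.card_fin]
  set C := cell H G Q ψ with hC
  have hdis : (I : Set (Fin h)).PairwiseDisjoint C := pairwiseDisjoint_cell hQ subset_rfl ψ
  have hsubbox : ((adjMaps H G).filter fun φ => ∀ x ∈ Q, φ x = ψ x) ⊆ box I C ψ := by
    intro φ hφ
    rw [Finset.mem_filter] at hφ
    exact mem_box_of_mem_adjMaps subset_rfl hφ.1 hφ.2
  have hprod : c < ∏ x ∈ I, ((C x).card : ℝ) := by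
    refine hψ.trans_le ?_
    rw [← Nat.cast_prod, ← card_box I C ψ]
    exact Nat.cast_le.2 (Finset.card_le_card hsubbox)
  have hm1 : h - (h - Q.card) = Q.card := by omega
  have hm2 : h - (h - Q.card - 1) = Q.card + 1 := by omega
  -- The largest possible product of cell sizes exceeds `c` by at most this factor, so any larger
  -- saving is contradictory. Each claim below is proved this way.
  have hbase : (n / (h - Q.card : ℕ)) ^ (h - Q.card) ≤ c * (Real.exp 1 * h) ^ Q.card := by
    have := div_pow_self_le (show h - Q.card ≤ h by omega) hh hn0
    rw [hm1] at this
    refine this.trans (le_of_eq ?_)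
    rw [hc]; ring
  have hcpos : 0 < n := by
    rcases hn0.eq_or_lt with h0 | h0
    · exfalso
      have h1 := hprod.trans_le (prod_card_cells_le hdis)
      rw [← hn, ← h0, hIc, zero_div, zero_pow (by omega)] at h1
      linarith
    · exact h0
  have hcp : 0 < c := by positivity
  have hsum : (1 - l) * n < ∑ x ∈ I, ((C x).card : ℝ) := by
    by_contra! hcon
    have h1 := hprod.trans_le (prod_le_div_pow I _ (fun _ _ => Nat.cast_nonneg _) hcon)
    rw [hIc, mul_div_assoc, mul_pow] at h1
    have h2 : (1 - l) ^ (h - Q.card) ≤ (1 - l) ^ (h - Q.card - 1) :=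
      pow_le_pow_of_le_one (by linarith) (by linarith) (by omega)
    have h3 : (Real.exp 1 * h) ^ Q.card ≤ (Real.exp 1 * h) ^ (Q.card + 1) :=
      pow_le_pow_right₀ he1 (by omega)
    have h0 : 0 ≤ 1 - l := by linarith
    have h4 : (1 - l) ^ (h - Q.card) * (n / (h - Q.card : ℕ)) ^ (h - Q.card) ≤
        (1 - l) ^ (h - Q.card - 1) * (c * (Real.exp 1 * h) ^ (Q.card + 1)) := by
      gcongr
      exact hbase.trans (by gcongr)
    nlinarith
  -- A larger cell would leave less than `(1 - l) * n` for the others. Bounding that one cell by `n`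
  -- costs one more factor `e * h`, hence the exponent `Q.card + 1`.
  have hcell : ∀ x ∈ I, ((C x).card : ℝ) ≤ l * n := by
    intro x hx
    by_contra! hcon
    have h0 : 0 ≤ 1 - l := by linarith
    have h1 : ∑ y ∈ I.erase x, ((C y).card : ℝ) ≤ (1 - l) * n := by
      have h2 := Finset.add_sum_erase I (fun y => ((C y).card : ℝ)) hx
      have h3 := sum_card_cells_le hdis
      linarith
    have h2 := prod_le_div_pow (I.erase x) _ (fun _ _ => Nat.cast_nonneg _) h1
    rw [Finset.card_erase_of_mem hx, hIc, mul_div_assoc, mul_pow] at h2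
    have h3 := div_pow_self_le (show h - Q.card - 1 ≤ h by omega) hh hn0
    rw [hm2] at h3
    have h4 : ((C x).card : ℝ) ≤ n := Nat.cast_le.2 (Finset.card_le_univ _)
    have h5 : n ^ (h - Q.card) = n * n ^ (h - Q.card - 1) := by
      rw [← pow_succ']
      congr 1
      omega
    rw [← Finset.mul_prod_erase I _ hx] at hprod
    have h6 : ((C x).card : ℝ) * ∏ y ∈ I.erase x, ((C y).card : ℝ) ≤
        n * ((1 - l) ^ (h - Q.card - 1) *
          (n ^ (h - Q.card - 1) * (Real.exp 1 * h) ^ (Q.card + 1) / (h : ℝ) ^ h)) :=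
      mul_le_mul h4 (h2.trans (mul_le_mul_of_nonneg_left h3 (pow_nonneg h0 _)))
        (Finset.prod_nonneg fun _ _ => Nat.cast_nonneg _) hn0
    have h7 : n * ((1 - l) ^ (h - Q.card - 1) *
          (n ^ (h - Q.card - 1) * (Real.exp 1 * h) ^ (Q.card + 1) / (h : ℝ) ^ h)) =
          c * ((1 - l) ^ (h - Q.card - 1) * (Real.exp 1 * h) ^ (Q.card + 1)) := by
      rw [hc, h5]; ring
    nlinarith
  let U : Finset V := I.biUnion C
  have hU : ((Uᶜ : Finset V).card : ℝ) ≤ l * n := by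
    have h1 : (U.card : ℝ) = ∑ x ∈ I, ((C x).card : ℝ) := by
      rw [← Nat.cast_sum, ← Finset.card_biUnion hdis]
    have h2 : (U.card : ℝ) + (Uᶜ : Finset V).card = n := by
      rw [hn, ← Nat.cast_add, Finset.card_add_card_compl U]
    linarith
  -- Uncovered vertices go to an arbitrary part; being at most `l * n` in number, they add at most
  -- `l * n` to a part and `2 * l * n ^ 2` bad pairs.
  let p : V → Fin h := fun w =>
    if hw : ∃ x, x ∈ I ∧ w ∈ C x then hw.choose else ⟨0, hh⟩
  have hp : ∀ x ∈ I, ∀ w ∈ C x, p w = x := by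
    intro x hx w hw
    have hex : ∃ x, x ∈ I ∧ w ∈ C x := ⟨x, hx, hw⟩
    have h1 : p w = hex.choose := dif_pos hex
    by_contra hne
    rw [h1] at hne
    exact Finset.disjoint_left.1 (hdis hex.choose_spec.1 hx hne) hex.choose_spec.2 hw
  have hpU : ∀ w ∈ U, p w ∈ I ∧ w ∈ C (p w) := by
    intro w hw
    obtain ⟨x, hx, hwx⟩ := Finset.mem_biUnion.1 hw
    rw [hp x hx w hwx]
    exact ⟨hx, hwx⟩
  refine ⟨p, fun i => ?_, ?_⟩
  · by_cases hi : i ∈ I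
    · have h1 : (Finset.univ.filter fun v => p v = i) ⊆ C i ∪ Uᶜ := by
        intro v hv
        have hv' : p v = i := by simpa using hv
        by_cases hvU : v ∈ U
        · exact Finset.mem_union_left _ (hv' ▸ (hpU v hvU).2)
        · exact Finset.mem_union_right _ (Finset.mem_compl.2 hvU)
      have h2 : ((Finset.univ.filter fun v => p v = i).card : ℝ) ≤
          ((C i).card : ℝ) + (Uᶜ : Finset V).card := by
        exact_mod_cast (Finset.card_le_card h1).trans (Finset.card_union_le _ _)
      linarith [hcell i hi]
    · have h1 : (Finset.univ.filter fun v => p v = i) ⊆ Uᶜ := by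
        intro v hv
        have hv' : p v = i := by simpa using hv
        exact Finset.mem_compl.2 fun hvU => hi (hv' ▸ (hpU v hvU).1)
      have h2 : ((Finset.univ.filter fun v => p v = i).card : ℝ) ≤ (Uᶜ : Finset V).card :=
        Nat.cast_le.2 (Finset.card_le_card h1)
      nlinarith
  -- The maps extending `ψ` are transversals without bad pairs, and `card_box_noPairs_le` makes
  -- these too rare if bad pairs are dense.
  · have hpairs : ∑ e ∈ I.offDiag, ((relPairs (Bad H G p) C e).card : ℝ) ≤
        (g * h ^ 2 + 4 * h * k) * (l * n) ^ 2 := by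
      by_contra! hcon
      have h1 := card_box_noPairs_le ψ (by positivity) hg hg1 k I hcell (by omega) hh hcon.le
      have h2 : ((adjMaps H G).filter fun φ => ∀ x ∈ Q, φ x = ψ x) ⊆
          (box I C ψ).filter fun φ => ∀ e ∈ I.offDiag, ¬ Bad H G p (φ e.1) (φ e.2) := by
        intro φ hφ
        have h3 := hsubbox hφ
        rw [Finset.mem_filter] at hφ ⊢
        refine ⟨h3, fun e he hbad => ?_⟩
        rw [Finset.mem_offDiag] at he
        have h4 := hp e.1 he.1 _ ((mem_box.1 h3).1 e.1 he.1)
        have h5 := hp e.2 he.2.1 _ ((mem_box.1 h3).1 e.2 he.2.1)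
        rw [Bad, h4, h5] at hbad
        exact hbad.2 (mem_adjMaps.1 hφ.1 e.1 e.2).symm
      have h3 := hψ.trans_le ((Nat.cast_le.2 (Finset.card_le_card h2)).trans h1)
      have h4 := prod_card_cells_le hdis
      rw [hIc, ← hn] at h4
      have h0 : 0 ≤ 1 - g := by linarith
      have h5 : (1 - g) ^ k * ∏ x ∈ I, ((C x).card : ℝ) ≤
          (1 - g) ^ k * (c * (Real.exp 1 * h) ^ Q.card) := by
        gcongr
        exact h4.trans hbase
      nlinarith
    have h1 : ((Finset.univ : Finset (V × V)).filter fun d => Bad H G p d.1 d.2) ⊆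
        I.offDiag.biUnion (relPairs (Bad H G p) C) ∪
          (Uᶜ ×ˢ Finset.univ ∪ Finset.univ ×ˢ Uᶜ) := by
      rintro ⟨u, v⟩ hd
      have hd' : Bad H G p u v := by simpa using hd
      by_cases hu : u ∈ U
      · by_cases hv : v ∈ U
        · refine Finset.mem_union_left _ (Finset.mem_biUnion.2 ⟨(p u, p v), ?_, ?_⟩)
          · exact Finset.mem_offDiag.2 ⟨(hpU u hu).1, (hpU v hv).1, hd'.1⟩
          · simp [relPairs, (hpU u hu).2, (hpU v hv).2, hd']
        · simp [hv]
      · simp [hu]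
    have h2 := (Finset.card_le_card h1).trans ((Finset.card_union_le _ _).trans
      (Nat.add_le_add_left (Finset.card_union_le _ _) _))
    rw [← sum_card_relPairs_eq hdis, Finset.card_product, Finset.card_product,
      Finset.card_univ] at h2
    have h3 : (((Finset.univ : Finset (V × V)).filter fun d => Bad H G p d.1 d.2).card : ℝ) ≤ _ :=
      Nat.cast_le.2 h2
    push_cast at h3
    rw [← hn] at h3
    nlinarith

end

/-! ### Atypical maps through a prescribed vertex -/

section
open scoped Classical

variable {h : ℕ} {V : Type*} [Fintype V]

theorem card_filter_card_le (h s : ℕ) :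
    ((Finset.univ : Finset (Finset (Fin h))).filter fun T => T.card ≤ s).card ≤ (h + 1) ^ s := by
  induction s with
  | zero =>
    rw [pow_zero, Finset.card_le_one]
    intro T hT T' hT'
    have h1 : T = ∅ := by simpa using hT
    have h2 : T' = ∅ := by simpa using hT'
    rw [h1, h2]
  | succ s ih =>
    set F := (Finset.univ : Finset (Finset (Fin h))).filter fun T => T.card ≤ s with hF
    have h1 : ((Finset.univ : Finset (Finset (Fin h))).filter fun T => T.card ≤ s + 1) ⊆
        F ∪ Finset.univ.biUnion fun x => F.image (insert x) := by
      intro T hT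
      have hT' : T.card ≤ s + 1 := by simpa using hT
      rcases T.eq_empty_or_nonempty with rfl | ⟨x, hx⟩
      · simp [hF]
      · refine Finset.mem_union_right _ (Finset.mem_biUnion.2 ⟨x, Finset.mem_univ _,
          Finset.mem_image.2 ⟨T.erase x, ?_, Finset.insert_erase hx⟩⟩)
        simp only [hF, Finset.mem_filter, Finset.mem_univ, true_and]
        rw [Finset.card_erase_of_mem hx]
        omega
    refine (Finset.card_le_card h1).trans ((Finset.card_union_le _ _).trans ?_)
    have h2 : (Finset.univ.biUnion fun x => F.image (insert x)).card ≤ h * F.card := by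
      refine Finset.card_biUnion_le.trans ?_
      refine (Finset.sum_le_card_nsmul _ _ F.card fun x _ => Finset.card_image_le).trans ?_
      simp
    rw [pow_succ]
    nlinarith

/-- Counting the maps that send `x` to `v` by their values on a set of positions. -/
theorem card_le_pow_mul_of_apply_eq {S : Finset (Fin h → V)} {x : Fin h} {v : V}
    (hS : ∀ φ ∈ S, φ x = v) {P : Finset (Fin h)} (hx : x ∈ P) {c : ℝ} (hc : 0 ≤ c)
    (hSP : ∀ ψ : Fin h → V, ∀ S' ⊆ S, (∀ φ ∈ S', ∀ y ∈ P, φ y = ψ y) → (S'.card : ℝ) ≤ c) :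
    (S.card : ℝ) ≤ (Fintype.card V : ℝ) ^ (P.card - 1) * c := by
  rw [← Finset.card_erase_of_mem hx]
  refine card_le_pow_mul S (P.erase x) hc fun ψ S' hS' hψ => ?_
  refine hSP (Function.update ψ x v) S' hS' fun φ hφ y hy => ?_
  by_cases hyx : y = x
  · subst hyx
    rw [Function.update_self, hS φ (hS' hφ)]
  · rw [Function.update_of_ne hyx]
    exact hψ φ hφ y (Finset.mem_erase.2 ⟨hyx, hy⟩)

/-- The common normalisation: `s` fixed positions of which one has a prescribed value, `r` positions
counted in related pairs, and `a` transversal positions. Each position that is not transversal costs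
`e * h` relative to `n ^ (h - 1) / h ^ h`. -/
theorem pow_mul_div_pow_le {a r s : ℕ} (hs : 1 ≤ s) (hsum : s + r + a = h) {n : ℝ} (hn : 0 ≤ n) :
    n ^ (s - 1) * (n ^ r * (n / a) ^ a) ≤
      n ^ (h - 1) / (h : ℝ) ^ h * (Real.exp 1 * h) ^ (h - a) := by
  have h1 := div_pow_self_le (show a ≤ h by omega) (by omega) hn
  calc n ^ (s - 1) * (n ^ r * (n / a) ^ a)
      ≤ n ^ (s - 1) * (n ^ r * (n ^ a * (Real.exp 1 * h) ^ (h - a) / (h : ℝ) ^ h)) := by gcongr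
    _ = n ^ (s - 1 + r + a) / (h : ℝ) ^ h * (Real.exp 1 * h) ^ (h - a) := by
        rw [pow_add, pow_add]; ring
    _ = _ := by rw [show s - 1 + r + a = h - 1 by omega]

theorem one_le_exp_mul (hh : 0 < h) : 1 ≤ Real.exp 1 * h := by
  have h1 : (1 : ℝ) ≤ h := by exact_mod_cast hh
  nlinarith [Real.add_one_le_exp (1 : ℝ)]

variable {H : SimpleGraph (Fin h)} {G : SimpleGraph V} {Q : Finset (Fin h)}

/-- Fix `Q` and `x`, then extract `k` disjoint bad pairs. Each gains `β / M` and costs two factors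
`e * h`, so the bound is useful when `M` is large compared with `h ^ 2 * β`. -/
theorem card_manyMismatches_apply_eq_le (hQ : IsDistinguishing H (Q : Set (Fin h)))
    (p : V → Fin h) {β M τ : ℝ} (hM : 0 < M) (hβ : 0 ≤ β)
    (hb : (((Finset.univ : Finset (V × V)).filter fun d => Bad H G p d.1 d.2).card : ℝ) ≤
      β * (Fintype.card V : ℝ) ^ 2) {k : ℕ} (hk : 2 * k + Q.card + 1 ≤ h)
    (hτ : M + 4 * h * k + 2 * h * (Q.card + 1) ≤ τ) (x : Fin h) (v : V) :
    (((adjMaps H G).filter fun φ => φ x = v ∧ τ < ((mismatches H (p ∘ φ)).card : ℝ)).card : ℝ) ≤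
      (Fintype.card V : ℝ) ^ (h - 1) / (h : ℝ) ^ h *
        ((Real.exp 1 * h) ^ (Q.card + 1) * ((Real.exp 1 * h) ^ 2 * β / M) ^ k) := by
  set n : ℝ := (Fintype.card V : ℝ) with hn
  have hn0 : 0 ≤ n := Nat.cast_nonneg _
  set P := insert x Q with hP
  have hPc : P.card ≤ Q.card + 1 := Finset.card_insert_le _ _
  have hP1 : 1 ≤ P.card := Finset.card_pos.2 ⟨x, Finset.mem_insert_self _ _⟩
  have hPc' : (P.card : ℝ) ≤ Q.card + 1 := by exact_mod_cast hPc
  have hh0 : (0 : ℝ) ≤ h := Nat.cast_nonneg _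
  set a := h - P.card - 2 * k with ha
  have h1 := card_le_pow_mul_of_apply_eq
    (S := (adjMaps H G).filter fun φ => φ x = v ∧ τ < ((mismatches H (p ∘ φ)).card : ℝ))
    (x := x) (v := v) (P := P) (c := (β * n ^ 2) ^ k * (n / (a : ℕ)) ^ a / M ^ k)
    (fun φ hφ => (Finset.mem_filter.1 hφ).2.1) (Finset.mem_insert_self _ _) (by positivity)
    (by
      intro ψ S' hS' hψ
      rw [le_div_iff₀ (by positivity)]
      refine le_trans ?_ (card_manyMismatches_le hQ (Finset.subset_insert x Q) p hM hb
        (show 2 * k + P.card ≤ h by omega) ψ)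
      gcongr
      intro φ hφ
      obtain ⟨hφE, -, hφτ⟩ := Finset.mem_filter.1 (hS' hφ)
      refine Finset.mem_filter.2 ⟨hφE, hψ φ hφ, ?_⟩
      have h2 : 2 * (h : ℝ) * P.card ≤ 2 * h * (Q.card + 1) := by gcongr
      linarith)
  refine h1.trans ?_
  rw [← hn]
  have h2 : n ^ (P.card - 1) * ((β * n ^ 2) ^ k * (n / (a : ℕ)) ^ a / M ^ k) =
      (n ^ (P.card - 1) * (n ^ (2 * k) * (n / a) ^ a)) * (β / M) ^ k := by
    rw [mul_pow, div_pow, pow_mul]; ring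
  have h3 := pow_mul_div_pow_le (s := P.card) (r := 2 * k) (a := a) (h := h) hP1 (by omega) hn0
  have h4 : (Real.exp 1 * h) ^ (h - a) ≤ (Real.exp 1 * h) ^ (Q.card + 1 + 2 * k) :=
    pow_le_pow_right₀ (one_le_exp_mul (by omega)) (by omega)
  rw [h2]
  calc _ ≤ (n ^ (h - 1) / (h : ℝ) ^ h * (Real.exp 1 * h) ^ (Q.card + 1 + 2 * k)) * (β / M) ^ k := by
        refine mul_le_mul_of_nonneg_right (h3.trans ?_) (by positivity)
        exact mul_le_mul_of_nonneg_left h4 (by positivity)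
    _ = _ := by
        rw [pow_add, pow_mul, mul_div_assoc ((Real.exp 1 * h) ^ 2), mul_pow _ (β / M)]; ring

/-- Of the factor `4 ^ h`, one `2 ^ h` chooses the fibre and the other comes from the doubling in
`prod_card_cells_inter_le`. -/
theorem card_largeFiber_apply_eq_le (hQ : IsDistinguishing H (Q : Set (Fin h)))
    {p : V → Fin h} {α : ℝ} (hα : 0 < α) (hα1 : α ≤ 1)
    (hp : ∀ i, ((Finset.univ.filter fun v => p v = i).card : ℝ) ≤ α * Fintype.card V)
    {f : ℕ} {τ : ℝ} (hf : f + Q.card + 1 ≤ τ) (hQh : Q.card < h) (x : Fin h) (v : V) :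
    (((adjMaps H G).filter fun φ => φ x = v ∧
      ∃ i, τ ≤ ((Finset.univ.filter fun x => p (φ x) = i).card : ℝ)).card : ℝ) ≤
      (Fintype.card V : ℝ) ^ (h - 1) / (h : ℝ) ^ h *
        (h * 4 ^ h * α ^ f * (Real.exp 1 * h) ^ (Q.card + 1)) := by
  set n : ℝ := (Fintype.card V : ℝ) with hn
  have hn0 : 0 ≤ n := Nat.cast_nonneg _
  set P := insert x Q with hP
  have hPc : P.card ≤ Q.card + 1 := Finset.card_insert_le _ _
  have hP1 : 1 ≤ P.card := Finset.card_pos.2 ⟨x, Finset.mem_insert_self _ _⟩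
  set a := h - P.card with ha
  have h1 := card_le_pow_mul_of_apply_eq
    (S := (adjMaps H G).filter fun φ => φ x = v ∧
      ∃ i, τ ≤ ((Finset.univ.filter fun x => p (φ x) = i).card : ℝ))
    (x := x) (v := v) (P := P) (c := (h * 2 ^ h) * (α ^ f * (2 * n / (a : ℕ)) ^ a))
    (fun φ hφ => (Finset.mem_filter.1 hφ).2.1) (Finset.mem_insert_self _ _) (by positivity)
    (by
      intro ψ S' hS' hψ
      refine le_trans ?_ (card_largeFiber_le (G := G) hQ (Finset.subset_insert x Q) hα hα1 hp f ψ)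
      refine Nat.cast_le.2 (Finset.card_le_card fun φ hφ => ?_)
      obtain ⟨hφE, -, i, hi⟩ := Finset.mem_filter.1 (hS' hφ)
      refine Finset.mem_filter.2 ⟨hφE, hψ φ hφ, i, ?_⟩
      have h2 : f + Q.card + 1 ≤ (Finset.univ.filter fun x => p (φ x) = i).card := by
        exact_mod_cast hf.trans hi
      change f + P.card ≤ _
      omega)
  refine h1.trans ?_
  rw [← hn]
  have h2 : n ^ (P.card - 1) * ((h * 2 ^ h) * (α ^ f * (2 * n / (a : ℕ)) ^ a)) =
      (n ^ (P.card - 1) * (n ^ 0 * (n / a) ^ a)) * (h * 2 ^ h * α ^ f * 2 ^ a) := by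
    rw [mul_div_assoc, mul_pow]; ring
  have h3 := pow_mul_div_pow_le (s := P.card) (r := 0) (a := a) (h := h) hP1 (by omega) hn0
  have h4 : (Real.exp 1 * h) ^ (h - a) ≤ (Real.exp 1 * h) ^ (Q.card + 1) :=
    pow_le_pow_right₀ (one_le_exp_mul (by omega)) (by omega)
  have h5 : (2 : ℝ) ^ a ≤ 2 ^ h := pow_le_pow_right₀ (by norm_num) (by omega)
  rw [h2]
  calc _ ≤ (n ^ (h - 1) / (h : ℝ) ^ h * (Real.exp 1 * h) ^ (Q.card + 1)) *
        (h * 2 ^ h * α ^ f * 2 ^ h) := by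
        refine mul_le_mul (h3.trans ?_) (mul_le_mul_of_nonneg_left h5 (by positivity))
          (by positivity) (by positivity)
        exact mul_le_mul_of_nonneg_left h4 (by positivity)
    _ = _ := by
        have h6 : (4 : ℝ) ^ h = 2 ^ h * 2 ^ h := by rw [← mul_pow]; norm_num
        rw [h6]; ring

theorem pairwiseDisjoint_fiber {V : Type*} [Fintype V] (p : V → Fin h) (I : Set (Fin h)) :
    I.PairwiseDisjoint fun z => Finset.univ.filter fun u => p u = z := by
  intro y _ z _ hyz
  refine Finset.disjoint_left.2 fun u hu hu' => hyz ?_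
  rw [← (Finset.mem_filter.1 hu).2, ← (Finset.mem_filter.1 hu').2]

/-- Few maps near the identity send `x` to `v`, if `v` does not fit into the part of `x`. -/
theorem card_nearId_apply_eq_le (p : V → Fin h) {x : Fin h} {v : V} {ρ : ℝ} (hρ : 0 ≤ ρ)
    (hρ1 : ρ ≤ 1) (hv : ρ * Fintype.card V ≤ ((Finset.univ.filter fun u => p u ≠ x ∧
      ¬ (G.Adj v u ↔ H.Adj x (p u))).card : ℝ)) {t : ℕ} (ht : t + 1 ≤ h) :
    (((adjMaps H G).filter fun φ => φ x = v ∧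
      (Finset.univ.filter fun z => p (φ z) ≠ z).card ≤ t).card : ℝ) ≤
      (Fintype.card V : ℝ) ^ (h - 1) / (h : ℝ) ^ h *
        ((h + 1) ^ (t + 1) * (Real.exp 1 * h) ^ (t + 1) * (1 - ρ) ^ (h - (t + 1))) := by
  set n : ℝ := (Fintype.card V : ℝ) with hn
  have hn0 : 0 ≤ n := Nat.cast_nonneg _
  set W := Finset.univ.filter fun u => p u ≠ x ∧ ¬ (G.Adj v u ↔ H.Adj x (p u)) with hW
  set 𝒯 := (Finset.univ : Finset (Finset (Fin h))).filter fun T => T.card ≤ t + 1 with h𝒯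
  -- Union bound over sets `T` containing `x` and all displaced positions; the values on `T` are
  -- then fixed.
  let B : Finset (Fin h) → Finset (Fin h → V) := fun T =>
    (adjMaps H G).filter fun φ => φ x = v ∧ x ∈ T ∧ ∀ z ∉ T, p (φ z) = z
  have hsub : ((adjMaps H G).filter fun φ => φ x = v ∧
      (Finset.univ.filter fun z => p (φ z) ≠ z).card ≤ t) ⊆ 𝒯.biUnion B := by
    intro φ hφ
    obtain ⟨hφE, hφx, hφt⟩ := Finset.mem_filter.1 hφ
    refine Finset.mem_biUnion.2 ⟨insert x (Finset.univ.filter fun z => p (φ z) ≠ z), ?_, ?_⟩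
    · simp only [h𝒯, Finset.mem_filter, Finset.mem_univ, true_and]
      exact (Finset.card_insert_le _ _).trans (by omega)
    · refine Finset.mem_filter.2 ⟨hφE, hφx, Finset.mem_insert_self _ _, fun z hz => ?_⟩
      simp only [Finset.mem_insert, Finset.mem_filter, Finset.mem_univ, true_and] at hz
      tauto
  have hB : ∀ T ∈ 𝒯, ((B T).card : ℝ) ≤ n ^ (h - 1) / (h : ℝ) ^ h *
      ((Real.exp 1 * h) ^ (t + 1) * (1 - ρ) ^ (h - (t + 1))) := by
    intro T hT
    have hTt : T.card ≤ t + 1 := (Finset.mem_filter.1 hT).2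
    by_cases hxT : x ∈ T
    swap
    · have : B T = ∅ := Finset.filter_eq_empty_iff.2 fun φ _ hφ => hxT hφ.2.1
      rw [this, Finset.card_empty, Nat.cast_zero]
      have : 0 ≤ 1 - ρ := by linarith
      positivity
    have hT1 : 1 ≤ T.card := Finset.card_pos.2 ⟨x, hxT⟩
    set a := h - T.card with ha
    have hac : (Tᶜ : Finset (Fin h)).card = a := by rw [Finset.card_compl, Fintype.card_fin]
    have hρ2 : 0 ≤ 1 - ρ := by linarith
    have h1 := card_le_pow_mul_of_apply_eq (S := B T)
      (x := x) (v := v) (P := T) (c := ((1 - ρ) * n / (a : ℕ)) ^ a)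
      (fun φ hφ => (Finset.mem_filter.1 hφ).2.1) hxT (by positivity)
      (by
        intro ψ S' hS' hψ
        -- For `z ∉ T` the vertex `φ z` lies in part `z` and is joined to `v` exactly as `z` is to
        -- `x`, hence avoids `W`. The remaining vertices number at most `(1 - ρ) * n`.
        have h2 : S' ⊆ box Tᶜ (fun z => (Finset.univ.filter fun u => p u = z) \ W) ψ := by
          intro φ hφ
          obtain ⟨hφE, hφx, -, hφT⟩ := Finset.mem_filter.1 (hS' hφ)
          refine mem_box.2 ⟨fun z hz => ?_, fun z hz => hψ φ hφ z (by simpa using hz)⟩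
          have hzT : z ∉ T := by simpa using hz
          have h3 := hφT z hzT
          simp only [hW, Finset.mem_sdiff, Finset.mem_filter, Finset.mem_univ, true_and, h3]
          rw [← hφx, ← mem_adjMaps.1 hφE x z]
          tauto
        refine (Nat.cast_le.2 (Finset.card_le_card h2)).trans ?_
        rw [card_box, Nat.cast_prod, ← hac]
        refine prod_le_div_pow _ _ (fun _ _ => Nat.cast_nonneg _) ?_
        have h3 : (∑ z ∈ Tᶜ, (((Finset.univ.filter fun u => p u = z) \ W).card) : ℝ) ≤
            ((Wᶜ : Finset V).card : ℝ) := by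
          rw [← Nat.cast_sum, ← Finset.card_biUnion]
          · refine Nat.cast_le.2 (Finset.card_le_card fun u hu => ?_)
            obtain ⟨z, -, hz⟩ := Finset.mem_biUnion.1 hu
            exact Finset.mem_compl.2 (Finset.mem_sdiff.1 hz).2
          · intro y hy z hz hyz
            exact (pairwiseDisjoint_fiber p Set.univ (Set.mem_univ y) (Set.mem_univ z) hyz).mono
              Finset.sdiff_subset Finset.sdiff_subset
        have h4 : (W.card : ℝ) + (Wᶜ : Finset V).card = n := by
          rw [hn, ← Nat.cast_add, Finset.card_add_card_compl W]
        linarith)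
    refine h1.trans ?_
    rw [← hn]
    have h2 : n ^ (T.card - 1) * ((1 - ρ) * n / (a : ℕ)) ^ a =
        (n ^ (T.card - 1) * (n ^ 0 * (n / a) ^ a)) * (1 - ρ) ^ a := by
      rw [mul_div_assoc, mul_pow]; ring
    have h3 := pow_mul_div_pow_le (s := T.card) (r := 0) (a := a) (h := h) hT1 (by omega) hn0
    have h4 : (Real.exp 1 * h) ^ (h - a) ≤ (Real.exp 1 * h) ^ (t + 1) :=
      pow_le_pow_right₀ (one_le_exp_mul (by omega)) (by omega)
    have h5 : (1 - ρ) ^ a ≤ (1 - ρ) ^ (h - (t + 1)) :=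
      pow_le_pow_of_le_one hρ2 (by linarith) (by omega)
    rw [h2]
    calc _ ≤ (n ^ (h - 1) / (h : ℝ) ^ h * (Real.exp 1 * h) ^ (t + 1)) *
          (1 - ρ) ^ (h - (t + 1)) := by
          refine mul_le_mul (h3.trans (by gcongr)) h5 (by positivity) (by positivity)
      _ = _ := by ring
  have hcard : (𝒯.card : ℝ) ≤ (h + 1) ^ (t + 1) := by
    exact_mod_cast card_filter_card_le h (t + 1)
  have hρ2 : 0 ≤ 1 - ρ := by linarith
  calc _ ≤ ((𝒯.biUnion B).card : ℝ) := Nat.cast_le.2 (Finset.card_le_card hsub)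
    _ ≤ ∑ T ∈ 𝒯, ((B T).card : ℝ) := by exact_mod_cast Finset.card_biUnion_le
    _ ≤ 𝒯.card • (n ^ (h - 1) / (h : ℝ) ^ h *
      ((Real.exp 1 * h) ^ (t + 1) * (1 - ρ) ^ (h - (t + 1)))) :=
        Finset.sum_le_card_nsmul _ _ _ hB
    _ ≤ (h + 1) ^ (t + 1) * (n ^ (h - 1) / (h : ℝ) ^ h *
      ((Real.exp 1 * h) ^ (t + 1) * (1 - ρ) ^ (h - (t + 1)))) := by
        rw [nsmul_eq_mul]
        gcongr
    _ = _ := by ring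

/-- Few maps near the identity send `y` to a vertex `v` of another part, if `v` is consistent with
most vertices. -/
theorem card_nearId_misplaced_le (hH : StronglyAsymmetric H) (p : V → Fin h) {y : Fin h} {v : V}
    (hy : p v ≠ y) {ρ : ℝ} (hρ : 0 < ρ) (hρ1 : ρ ≤ 1)
    (hv : ((Finset.univ.filter fun u => Bad H G p v u).card : ℝ) ≤ ρ * Fintype.card V) {t f : ℕ}
    (ht : t ≤ h) (hf : (f + t + 2 : ℝ) ≤ (45 / 100 : ℝ) * h) :
    (((adjMaps H G).filter fun φ => φ y = v ∧
      (Finset.univ.filter fun z => p (φ z) ≠ z).card ≤ t).card : ℝ) ≤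
      (Fintype.card V : ℝ) ^ (h - 1) / (h : ℝ) ^ h *
        ((h + 1) ^ t * (Real.exp 1 * h) ^ t * (2 ^ h * ρ ^ f)) := by
  set n : ℝ := (Fintype.card V : ℝ) with hn
  have hn0 : 0 ≤ n := Nat.cast_nonneg _
  set W := Finset.univ.filter fun u => Bad H G p v u with hW
  set 𝒯 := (Finset.univ : Finset (Finset (Fin h))).filter fun T => T.card ≤ t with h𝒯
  let B : Finset (Fin h) → Finset (Fin h → V) := fun T =>
    (adjMaps H G).filter fun φ => φ y = v ∧ y ∈ T ∧ ∀ z ∉ T, p (φ z) = z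
  have hsub : ((adjMaps H G).filter fun φ => φ y = v ∧
      (Finset.univ.filter fun z => p (φ z) ≠ z).card ≤ t) ⊆ 𝒯.biUnion B := by
    intro φ hφ
    obtain ⟨hφE, hφx, hφt⟩ := Finset.mem_filter.1 hφ
    refine Finset.mem_biUnion.2 ⟨Finset.univ.filter fun z => p (φ z) ≠ z, ?_, ?_⟩
    · simpa only [h𝒯, Finset.mem_filter, Finset.mem_univ, true_and] using hφt
    · refine Finset.mem_filter.2 ⟨hφE, hφx, ?_, fun z hz => ?_⟩
      · simpa [hφx] using hy
      · simpa using hz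
  have hB : ∀ T ∈ 𝒯, ((B T).card : ℝ) ≤ n ^ (h - 1) / (h : ℝ) ^ h *
      ((Real.exp 1 * h) ^ t * (2 ^ h * ρ ^ f)) := by
    intro T hT
    have hTt : T.card ≤ t := (Finset.mem_filter.1 hT).2
    by_cases hyT : y ∈ T
    swap
    · have : B T = ∅ := Finset.filter_eq_empty_iff.2 fun φ _ hφ => hyT hφ.2.1
      rw [this, Finset.card_empty, Nat.cast_zero]
      positivity
    have hT1 : 1 ≤ T.card := Finset.card_pos.2 ⟨y, hyT⟩
    set a := h - T.card with ha
    have hac : (Tᶜ : Finset (Fin h)).card = a := by rw [Finset.card_compl, Fintype.card_fin]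
    -- At a position distinguishing `y` from `p v`, the image is joined to `v` as `y` prescribes, so
    -- it is bad with `v` and lies in `W`. The pair condition leaves at least `0.45 * h - t - 2`
    -- such positions.
    set Z := (Tᶜ : Finset (Fin h)).filter fun z => z ≠ p v ∧ ¬ (H.Adj z y ↔ H.Adj z (p v)) with hZ
    have hZf : f ≤ Z.card := by
      have h1 : (Finset.univ : Finset (Fin h)) ⊆ Z ∪ (T ∪ ({y, p v} ∪
          Finset.univ.filter fun z => z ≠ y ∧ z ≠ p v ∧ (H.Adj z y ↔ H.Adj z (p v)))) := by
        intro z _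
        simp only [hZ, Finset.mem_union, Finset.mem_filter, Finset.mem_compl, Finset.mem_insert,
          Finset.mem_singleton, Finset.mem_univ, true_and]
        tauto
      have h2 := (Finset.card_le_card h1).trans ((Finset.card_union_le _ _).trans
        (Nat.add_le_add_left ((Finset.card_union_le _ _).trans (Nat.add_le_add_left
        (Finset.card_union_le _ _) _)) _))
      rw [Finset.card_univ, Fintype.card_fin, Finset.card_pair (Ne.symm hy)] at h2
      have h3 : (h : ℝ) ≤ _ := Nat.cast_le.2 h2
      push_cast at h3
      have h4 := card_filter_agree_pair_le hH (Ne.symm hy)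
      have h5 : (T.card : ℝ) ≤ t := Nat.cast_le.2 hTt
      have h6 : (f : ℝ) ≤ Z.card := by linarith
      exact_mod_cast h6
    have h1 := card_le_pow_mul_of_apply_eq (S := B T)
      (x := y) (v := v) (P := T) (c := ρ ^ f * (2 * n / (a : ℕ)) ^ a)
      (fun φ hφ => (Finset.mem_filter.1 hφ).2.1) hyT (by positivity)
      (by
        intro ψ S' hS' hψ
        have h2 : S' ⊆ box Tᶜ (fun z => if z ∈ Z then (Finset.univ.filter fun u => p u = z) ∩ W
            else (Finset.univ.filter fun u => p u = z)) ψ := by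
          intro φ hφ
          obtain ⟨hφE, hφy, -, hφT⟩ := Finset.mem_filter.1 (hS' hφ)
          refine mem_box.2 ⟨fun z hz => ?_, fun z hz => hψ φ hφ z (by simpa using hz)⟩
          have hzT : z ∉ T := by simpa using hz
          have h3 := hφT z hzT
          split_ifs with hzZ
          · have h4 := (Finset.mem_filter.1 hzZ).2
            refine Finset.mem_inter.2 ⟨by simp [h3], Finset.mem_filter.2 ⟨Finset.mem_univ _, ?_⟩⟩
            rw [Bad, h3]
            refine ⟨Ne.symm h4.1, ?_⟩
            rw [← hφy, ← mem_adjMaps.1 hφE y z, hφy, H.adj_comm y, H.adj_comm (p v)]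
            exact h4.2
          · simp [h3]
        refine (Nat.cast_le.2 (Finset.card_le_card h2)).trans ?_
        rw [card_box, Nat.cast_prod]
        have h3 := prod_card_cells_inter_le (pairwiseDisjoint_fiber p _)
          (Finset.filter_subset _ _ : Z ⊆ Tᶜ) hρ hv
        rw [hac, ← hn] at h3
        refine h3.trans ?_
        exact mul_le_mul_of_nonneg_right (pow_le_pow_of_le_one hρ.le hρ1 hZf) (by positivity))
    refine h1.trans ?_
    rw [← hn]
    have h2 : n ^ (T.card - 1) * (ρ ^ f * (2 * n / (a : ℕ)) ^ a) =
        (n ^ (T.card - 1) * (n ^ 0 * (n / a) ^ a)) * (2 ^ a * ρ ^ f) := by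
      rw [mul_div_assoc, mul_pow]; ring
    have h3 := pow_mul_div_pow_le (s := T.card) (r := 0) (a := a) (h := h) hT1 (by omega) hn0
    have h4 : (Real.exp 1 * h) ^ (h - a) ≤ (Real.exp 1 * h) ^ t :=
      pow_le_pow_right₀ (one_le_exp_mul (by omega)) (by omega)
    have h5 : (2 : ℝ) ^ a ≤ 2 ^ h := pow_le_pow_right₀ (by norm_num) (by omega)
    rw [h2]
    calc _ ≤ (n ^ (h - 1) / (h : ℝ) ^ h * (Real.exp 1 * h) ^ t) * (2 ^ h * ρ ^ f) := by
          refine mul_le_mul (h3.trans (by gcongr)) (by gcongr) (by positivity) (by positivity)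
      _ = _ := by ring
  have hcard : (𝒯.card : ℝ) ≤ (h + 1) ^ t := by
    exact_mod_cast card_filter_card_le h t
  calc _ ≤ ((𝒯.biUnion B).card : ℝ) := Nat.cast_le.2 (Finset.card_le_card hsub)
    _ ≤ ∑ T ∈ 𝒯, ((B T).card : ℝ) := by exact_mod_cast Finset.card_biUnion_le
    _ ≤ 𝒯.card • (n ^ (h - 1) / (h : ℝ) ^ h * ((Real.exp 1 * h) ^ t * (2 ^ h * ρ ^ f))) :=
        Finset.sum_le_card_nsmul _ _ _ hB
    _ ≤ (h + 1) ^ t * (n ^ (h - 1) / (h : ℝ) ^ h *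
        ((Real.exp 1 * h) ^ t * (2 ^ h * ρ ^ f))) := by
        rw [nsmul_eq_mul]
        gcongr
    _ = _ := by ring

end

/-! ### Correcting the partition and counting all maps -/

section
open scoped Classical

variable {h : ℕ} {V : Type*} [Fintype V]
  {H : SimpleGraph (Fin h)} {G : SimpleGraph V} {Q : Finset (Fin h)}

set_option maxHeartbeats 400000 in
/-- A vertex contained in many copies of `H` fits into one of the parts. -/
theorem exists_fitting_part (hH : StronglyAsymmetric H) (hh : 1000 ≤ h)
    (hQ : IsDistinguishing H (Q : Set (Fin h))) {p : V → Fin h} {α β M μ ρ η : ℝ} {k f t : ℕ}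
    (hα : 0 < α) (hα1 : α ≤ 1) (hβ : 0 ≤ β) (hM : 0 < M) (hμ : μ ≤ 1 / 10 ^ 6)
    (hρ : 0 ≤ ρ) (hρ1 : ρ ≤ 1)
    (hp : ∀ i, ((Finset.univ.filter fun v => p v = i).card : ℝ) ≤ α * Fintype.card V)
    (hb : (((Finset.univ : Finset (V × V)).filter fun d => Bad H G p d.1 d.2).card : ℝ) ≤
      β * (Fintype.card V : ℝ) ^ 2)
    (hk : 2 * k + Q.card + 1 ≤ h) (hτ : M + 4 * h * k + 2 * h * (Q.card + 1) ≤ μ * h ^ 2)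
    (hf : (f + Q.card + 1 : ℝ) ≤ 69 / 100 * h) (ht : 25 * μ * h ≤ t) (ht1 : t + 1 ≤ h)
    (hη : h * ((Real.exp 1 * h) ^ (Q.card + 1) * ((Real.exp 1 * h) ^ 2 * β / M) ^ k +
      h * 4 ^ h * α ^ f * (Real.exp 1 * h) ^ (Q.card + 1) +
      (h + 1) ^ (t + 1) * (Real.exp 1 * h) ^ (t + 1) * (1 - ρ) ^ (h - (t + 1))) < η)
    {v : V} (hv : η * ((Fintype.card V : ℝ) ^ (h - 1) / (h : ℝ) ^ h) ≤
      (((adjMaps H G).filter fun φ => ∃ x, φ x = v).card : ℝ)) :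
    ∃ x, ((Finset.univ.filter fun u => p u ≠ x ∧ ¬ (G.Adj v u ↔ H.Adj x (p u))).card : ℝ) ≤
      ρ * Fintype.card V := by
  by_contra hcon
  have hh0 : 0 < h := by omega
  set n : ℝ := (Fintype.card V : ℝ) with hn
  have hn0 : 0 < n := by
    have : Nonempty V := ⟨v⟩
    rw [hn]
    exact_mod_cast Fintype.card_pos (α := V)
  set D : ℝ := n ^ (h - 1) / (h : ℝ) ^ h with hD
  have hh0' : (0 : ℝ) < h := by exact_mod_cast hh0
  have hD0 : 0 < D := by positivity
  set K₀ := (Real.exp 1 * h) ^ (Q.card + 1) * ((Real.exp 1 * h) ^ 2 * β / M) ^ k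
  set K₁ := h * 4 ^ h * α ^ f * (Real.exp 1 * h) ^ (Q.card + 1)
  set K₂ := (h + 1 : ℝ) ^ (t + 1) * (Real.exp 1 * h) ^ (t + 1) * (1 - ρ) ^ (h - (t + 1))
  -- The three kinds of maps through `v`: many mismatches, a large fibre, near the identity. If `v`
  -- fits no part, even the third kind is rare, for each of the `h` positions.
  let S₀ : Fin h → Finset (Fin h → V) := fun x => (adjMaps H G).filter fun φ =>
    φ x = v ∧ μ * h ^ 2 < ((mismatches H (p ∘ φ)).card : ℝ)
  let S₁ : Fin h → Finset (Fin h → V) := fun x => (adjMaps H G).filter fun φ =>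
    φ x = v ∧ ∃ i, 69 / 100 * (h : ℝ) ≤ ((Finset.univ.filter fun x => p (φ x) = i).card : ℝ)
  let S₂ : Fin h → Finset (Fin h → V) := fun x => (adjMaps H G).filter fun φ =>
    φ x = v ∧ (Finset.univ.filter fun z => p (φ z) ≠ z).card ≤ t
  have hS₀ : ∀ x, ((S₀ x).card : ℝ) ≤ D * K₀ := fun x =>
    card_manyMismatches_apply_eq_le hQ p hM hβ hb hk hτ x v
  have hS₁ : ∀ x, ((S₁ x).card : ℝ) ≤ D * K₁ := fun x =>
    card_largeFiber_apply_eq_le hQ hα hα1 hp hf (by omega) x v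
  have hS₂ : ∀ x, ((S₂ x).card : ℝ) ≤ D * K₂ := fun x =>
    card_nearId_apply_eq_le p hρ hρ1 (not_le.1 fun hle => hcon ⟨x, hle⟩).le ht1
  have hsub : ((adjMaps H G).filter fun φ => ∃ x, φ x = v) ⊆
      Finset.univ.biUnion fun x => S₀ x ∪ (S₁ x ∪ S₂ x) := by
    intro φ hφ
    obtain ⟨hφE, x, hx⟩ := Finset.mem_filter.1 hφ
    refine Finset.mem_biUnion.2 ⟨x, Finset.mem_univ _, ?_⟩
    by_cases hmis : μ * h ^ 2 < ((mismatches H (p ∘ φ)).card : ℝ)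
    · exact Finset.mem_union_left _ (Finset.mem_filter.2 ⟨hφE, hx, hmis⟩)
    · rcases near_id_or_large_fiber hH hh (p ∘ φ) hμ (not_lt.1 hmis) with h1 | ⟨i, hi⟩
      · exact Finset.mem_union_right _ (Finset.mem_union_right _ (Finset.mem_filter.2
          ⟨hφE, hx, by exact_mod_cast h1.trans ht⟩))
      · exact Finset.mem_union_right _ (Finset.mem_union_left _ (Finset.mem_filter.2
          ⟨hφE, hx, i, hi⟩))
  have hcount : (((adjMaps H G).filter fun φ => ∃ x, φ x = v).card : ℝ) ≤
      h * (D * K₀ + (D * K₁ + D * K₂)) := by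
    calc _ ≤ ((Finset.univ.biUnion fun x => S₀ x ∪ (S₁ x ∪ S₂ x)).card : ℝ) :=
          Nat.cast_le.2 (Finset.card_le_card hsub)
      _ ≤ ∑ x, ((S₀ x ∪ (S₁ x ∪ S₂ x)).card : ℝ) := by exact_mod_cast Finset.card_biUnion_le
      _ ≤ ∑ _x : Fin h, (D * K₀ + (D * K₁ + D * K₂)) := by
          refine Finset.sum_le_sum fun x _ => ?_
          have h1 : ((S₀ x ∪ (S₁ x ∪ S₂ x)).card : ℝ) ≤
              (S₀ x).card + ((S₁ x).card + (S₂ x).card) := by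
            exact_mod_cast (Finset.card_union_le _ _).trans
              (Nat.add_le_add_left (Finset.card_union_le _ _) _)
          linarith [hS₀ x, hS₁ x, hS₂ x]
      _ = _ := by
          rw [Finset.sum_const, Finset.card_univ, Fintype.card_fin, nsmul_eq_mul]
  have h1 : D * (h * (K₀ + K₁ + K₂)) < D * η := mul_lt_mul_of_pos_left hη hD0
  linarith

theorem card_le_of_forall_apply_eq (S : Finset (Fin h → V)) (y : Fin h) {c : ℝ}
    (hS : ∀ v, ((S.filter fun φ => φ y = v).card : ℝ) ≤ c) :
    (S.card : ℝ) ≤ Fintype.card V * c := by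
  have h1 := Finset.card_eq_sum_card_fiberwise (f := fun φ : Fin h → V => φ y) (s := S)
    (t := Finset.univ) (by simp)
  rw [h1, Nat.cast_sum]
  refine (Finset.sum_le_card_nsmul _ _ c fun v _ => hS v).trans ?_
  rw [nsmul_eq_mul, Finset.card_univ]

/-- If most vertices fit into their part, then most maps respect the partition. -/
theorem card_adjMaps_le_of_partition (hH : StronglyAsymmetric H) (hh : 1000 ≤ h)
    (hQ : IsDistinguishing H (Q : Set (Fin h))) {p : V → Fin h} {α β M μ ρ η : ℝ} {k f f' t : ℕ}
    (hα : 0 < α) (hα1 : α ≤ 1) (hβ : 0 ≤ β) (hM : 0 < M) (hμ : μ ≤ 1 / 10 ^ 6)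
    (hρ : 0 < ρ) (hρ1 : ρ ≤ 1) (hη : 0 ≤ η)
    (hp : ∀ i, ((Finset.univ.filter fun v => p v = i).card : ℝ) ≤ α * Fintype.card V)
    (hb : (((Finset.univ : Finset (V × V)).filter fun d => Bad H G p d.1 d.2).card : ℝ) ≤
      β * (Fintype.card V : ℝ) ^ 2)
    (hfit : ∀ v, ((Finset.univ.filter fun u => Bad H G p v u).card : ℝ) ≤ ρ * Fintype.card V ∨
      (((adjMaps H G).filter fun φ => ∃ x, φ x = v).card : ℝ) ≤
        η * ((Fintype.card V : ℝ) ^ (h - 1) / (h : ℝ) ^ h))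
    (hk : 2 * k + Q.card + 1 ≤ h) (hτ : M + 4 * h * k + 2 * h * (Q.card + 1) ≤ μ * h ^ 2)
    (hf : (f + Q.card + 1 : ℝ) ≤ 69 / 100 * h) (ht : 25 * μ * h ≤ t) (ht1 : t ≤ h)
    (hf' : (f' + t + 2 : ℝ) ≤ 45 / 100 * h) :
    ((adjMaps H G).card : ℝ) ≤ (Fintype.card V : ℝ) ^ h / (h : ℝ) ^ h *
      (1 + η + (Real.exp 1 * h) ^ (Q.card + 1) * ((Real.exp 1 * h) ^ 2 * β / M) ^ k +
      h * 4 ^ h * α ^ f * (Real.exp 1 * h) ^ (Q.card + 1) +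
      h * ((h + 1) ^ t * (Real.exp 1 * h) ^ t * (2 ^ h * ρ ^ f'))) := by
  have hh0 : 0 < h := by omega
  set n : ℝ := (Fintype.card V : ℝ) with hn
  have hn0 : 0 ≤ n := Nat.cast_nonneg _
  set D : ℝ := n ^ (h - 1) / (h : ℝ) ^ h with hD
  have hD0 : 0 ≤ D := by positivity
  have hnD : n * D = n ^ h / (h : ℝ) ^ h := by
    rw [hD, ← mul_div_assoc, ← pow_succ', Nat.sub_add_cancel (by omega)]
  let y₀ : Fin h := ⟨0, hh0⟩
  set K₀ := (Real.exp 1 * h) ^ (Q.card + 1) * ((Real.exp 1 * h) ^ 2 * β / M) ^ k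
  set K₁ := h * 4 ^ h * α ^ f * (Real.exp 1 * h) ^ (Q.card + 1)
  set K₂ := (h + 1 : ℝ) ^ t * (Real.exp 1 * h) ^ t * (2 ^ h * ρ ^ f')
  -- Vertices used by few maps need not fit their part: all maps through them number at most `n * η
  -- * D = η * n ^ h / h ^ h`.
  set L := Finset.univ.filter fun v => (((adjMaps H G).filter fun φ => ∃ x, φ x = v).card : ℝ) ≤
        η * D with hL
  let SL : Finset (Fin h → V) := L.biUnion fun v => (adjMaps H G).filter fun φ => ∃ x, φ x = v
  let S₀ : Finset (Fin h → V) := (adjMaps H G).filter fun φ =>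
    μ * h ^ 2 < ((mismatches H (p ∘ φ)).card : ℝ)
  let S₁ : Finset (Fin h → V) := (adjMaps H G).filter fun φ =>
    ∃ i, 69 / 100 * (h : ℝ) ≤ ((Finset.univ.filter fun x => p (φ x) = i).card : ℝ)
  let S₂ : Fin h → Finset (Fin h → V) := fun y => (adjMaps H G).filter fun φ =>
    (p (φ y) ≠ y ∧ φ y ∉ L) ∧ (Finset.univ.filter fun z => p (φ z) ≠ z).card ≤ t
  let SR : Finset (Fin h → V) := (adjMaps H G).filter fun φ => ∀ z, p (φ z) = z
  have hSL : (SL.card : ℝ) ≤ n * (η * D) := by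
    have h1 : (SL.card : ℝ) ≤ ∑ v ∈ L, (((adjMaps H G).filter fun φ => ∃ x, φ x = v).card : ℝ) := by
      exact_mod_cast Finset.card_biUnion_le
    have h2 := h1.trans (Finset.sum_le_card_nsmul _ _ (η * D) fun v hv =>
      (Finset.mem_filter.1 hv).2)
    rw [nsmul_eq_mul] at h2
    refine h2.trans (mul_le_mul_of_nonneg_right ?_ (by positivity))
    exact Nat.cast_le.2 (Finset.card_le_univ _)
  have hS₀ : (S₀.card : ℝ) ≤ n * (D * K₀) := by
    refine card_le_of_forall_apply_eq S₀ y₀ fun v => ?_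
    refine le_trans (Nat.cast_le.2 (Finset.card_le_card fun φ hφ => ?_))
      (card_manyMismatches_apply_eq_le (G := G) hQ p hM hβ hb hk hτ y₀ v)
    obtain ⟨h1, h2⟩ := Finset.mem_filter.1 hφ
    obtain ⟨h3, h4⟩ := Finset.mem_filter.1 h1
    exact Finset.mem_filter.2 ⟨h3, h2, h4⟩
  have hS₁ : (S₁.card : ℝ) ≤ n * (D * K₁) := by
    refine card_le_of_forall_apply_eq S₁ y₀ fun v => ?_
    refine le_trans (Nat.cast_le.2 (Finset.card_le_card fun φ hφ => ?_))
      (card_largeFiber_apply_eq_le (G := G) hQ hα hα1 hp hf (by omega) y₀ v)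
    obtain ⟨h1, h2⟩ := Finset.mem_filter.1 hφ
    obtain ⟨h3, h4⟩ := Finset.mem_filter.1 h1
    exact Finset.mem_filter.2 ⟨h3, h2, h4⟩
  have hS₂ : ∀ y, ((S₂ y).card : ℝ) ≤ n * (D * K₂) := by
    intro y
    refine card_le_of_forall_apply_eq (S₂ y) y fun v => ?_
    by_cases hv : p v ≠ y ∧ v ∉ L
    · have hvL : ((Finset.univ.filter fun u => Bad H G p v u).card : ℝ) ≤ ρ * n := by
        rcases hfit v with h1 | h1
        · exact h1
        · have hvL : v ∈ L := Finset.mem_filter.2 ⟨Finset.mem_univ _, h1⟩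
          exact absurd hvL hv.2
      refine le_trans (Nat.cast_le.2 (Finset.card_le_card fun φ hφ => ?_))
        (card_nearId_misplaced_le hH p hv.1 hρ hρ1 hvL ht1 hf')
      obtain ⟨h1, h2⟩ := Finset.mem_filter.1 hφ
      obtain ⟨h3, -, h4⟩ := Finset.mem_filter.1 h1
      exact Finset.mem_filter.2 ⟨h3, h2, h4⟩
    · have h0 : (S₂ y).filter (fun φ => φ y = v) = ∅ := by
        refine Finset.filter_eq_empty_iff.2 fun φ hφ hφv => hv ?_
        exact hφv ▸ (Finset.mem_filter.1 hφ).2.1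
      rw [h0, Finset.card_empty, Nat.cast_zero]
      positivity
  -- The main term: maps respecting the partition are transversals of its parts.
  have hSR : (SR.card : ℝ) ≤ n ^ h / (h : ℝ) ^ h := by
    have h1 : SR ⊆ Fintype.piFinset fun z => Finset.univ.filter fun u => p u = z := by
      intro φ hφ
      simpa [Fintype.mem_piFinset] using (Finset.mem_filter.1 hφ).2
    have h2 := prod_card_cells_le (pairwiseDisjoint_fiber p
      ((Finset.univ : Finset (Fin h)) : Set (Fin h)))
    rw [Finset.card_univ, Fintype.card_fin, div_pow] at h2
    refine le_trans ?_ h2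
    rw [← Nat.cast_prod, ← Fintype.card_piFinset]
    exact Nat.cast_le.2 (Finset.card_le_card h1)
  have hsub : adjMaps H G ⊆ SL ∪ (S₀ ∪ (S₁ ∪ (SR ∪ Finset.univ.biUnion S₂))) := by
    intro φ hφE
    by_cases hφL : ∃ x, φ x ∈ L
    · obtain ⟨x, hx⟩ := hφL
      exact Finset.mem_union_left _ (Finset.mem_biUnion.2 ⟨_, hx, Finset.mem_filter.2
        ⟨hφE, x, rfl⟩⟩)
    refine Finset.mem_union_right _ ?_
    by_cases hmis : μ * h ^ 2 < ((mismatches H (p ∘ φ)).card : ℝ)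
    · exact Finset.mem_union_left _ (Finset.mem_filter.2 ⟨hφE, hmis⟩)
    refine Finset.mem_union_right _ ?_
    rcases near_id_or_large_fiber hH hh (p ∘ φ) hμ (not_lt.1 hmis) with h1 | ⟨i, hi⟩
    swap
    · exact Finset.mem_union_left _ (Finset.mem_filter.2 ⟨hφE, i, hi⟩)
    refine Finset.mem_union_right _ ?_
    by_cases hid : ∀ z, p (φ z) = z
    · exact Finset.mem_union_left _ (Finset.mem_filter.2 ⟨hφE, hid⟩)
    push Not at hid
    obtain ⟨y, hy⟩ := hid
    exact Finset.mem_union_right _ (Finset.mem_biUnion.2 ⟨y, Finset.mem_univ _,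
      Finset.mem_filter.2 ⟨hφE, ⟨hy, fun hyL => hφL ⟨y, hyL⟩⟩, by exact_mod_cast h1.trans ht⟩⟩)
  have hS₂' : ((Finset.univ.biUnion S₂).card : ℝ) ≤ h * (n * (D * K₂)) := by
    have h1 : ((Finset.univ.biUnion S₂).card : ℝ) ≤ ∑ y, ((S₂ y).card : ℝ) := by
      exact_mod_cast Finset.card_biUnion_le
    refine h1.trans ((Finset.sum_le_card_nsmul _ _ _ fun y _ => hS₂ y).trans ?_)
    simp
  have hfinal : ((adjMaps H G).card : ℝ) ≤
      SL.card + (S₀.card + (S₁.card + (SR.card + (Finset.univ.biUnion S₂).card))) := by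
    have h1 := (Finset.card_le_card hsub).trans ((Finset.card_union_le _ _).trans
      (Nat.add_le_add_left ((Finset.card_union_le _ _).trans (Nat.add_le_add_left
      ((Finset.card_union_le _ _).trans (Nat.add_le_add_left (Finset.card_union_le _ _) _)) _)) _))
    exact_mod_cast h1
  rw [← hnD] at hSR ⊢
  linarith

set_option maxHeartbeats 400000 in
/-- The number of induced copies of a strongly asymmetric graph, under numerical assumptions on
the parameters of the proof. -/
theorem card_adjMaps_le_of_parameters (hH : StronglyAsymmetric H) (hh : 1000 ≤ h)
    (hQ : IsDistinguishing H (Q : Set (Fin h))) {l g r α β₀ β M μ ρ η : ℝ} {j k f f' t : ℕ}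
    (hl : 0 < l) (hl1 : l ≤ 1) (hg : 0 ≤ g) (hg1 : g ≤ 1)
    (hα1 : α ≤ 1) (hM : 0 < M) (hμ : μ ≤ 1 / 10 ^ 6) (hρ : 0 < ρ) (hρ1 : 2 * ρ ≤ 1) (hr : 0 ≤ r)
    (hll : (1 - l) ^ (h - Q.card - 1) * (Real.exp 1 * h) ^ (Q.card + 1) < 1)
    (hgj : (1 - g) ^ j * (Real.exp 1 * h) ^ Q.card < 1)
    (hβ₀ : (g * h ^ 2 + 4 * h * j) * l ^ 2 + 2 * l ≤ β₀) (hβr : β₀ ≤ r * ρ) (hrρ : r ≤ ρ)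
    (hβ : β₀ + 2 * r ≤ β) (hα : 2 * l + r ≤ α)
    (hk : 2 * k + Q.card + 1 ≤ h) (hτ : M + 4 * h * k + 2 * h * (Q.card + 1) ≤ μ * h ^ 2)
    (hf : (f + Q.card + 1 : ℝ) ≤ 69 / 100 * h) (ht : 25 * μ * h ≤ t)
    (hf' : (f' + t + 2 : ℝ) ≤ 45 / 100 * h)
    (hη : h * ((Real.exp 1 * h) ^ (Q.card + 1) * ((Real.exp 1 * h) ^ 2 * β / M) ^ k +
      h * 4 ^ h * α ^ f * (Real.exp 1 * h) ^ (Q.card + 1) +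
      (h + 1) ^ (t + 1) * (Real.exp 1 * h) ^ (t + 1) * (1 - ρ) ^ (h - (t + 1))) < η)
    (hη' : h * ((h + 1) ^ t * (Real.exp 1 * h) ^ t * (2 ^ h * (2 * ρ) ^ f')) ≤ η) :
    ((adjMaps H G).card : ℝ) ≤ (Fintype.card V : ℝ) ^ h / (h : ℝ) ^ h * (1 + 3 * η) := by
  have hh0 : 0 < h := by omega
  have hh1 : (1000 : ℝ) ≤ h := by exact_mod_cast hh
  set n : ℝ := (Fintype.card V : ℝ) with hn
  have hn0 : 0 ≤ n := Nat.cast_nonneg _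
  have hβ₀0 : 0 ≤ β₀ := le_trans (by positivity) hβ₀
  have hβ0 : 0 ≤ β := by linarith
  have hα0 : 0 < α := by linarith
  have ht1 : t + 1 ≤ h := by
    have : (t + 1 : ℝ) ≤ h := by linarith [Nat.cast_nonneg (α := ℝ) f']
    exact_mod_cast this
  set K₀ := (Real.exp 1 * h) ^ (Q.card + 1) * ((Real.exp 1 * h) ^ 2 * β / M) ^ k with hK₀
  set K₁ := h * 4 ^ h * α ^ f * (Real.exp 1 * h) ^ (Q.card + 1) with hK₁
  set K₂ := (h + 1 : ℝ) ^ (t + 1) * (Real.exp 1 * h) ^ (t + 1) * (1 - ρ) ^ (h - (t + 1)) with hK₂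
  have hK₀0 : 0 ≤ K₀ := by positivity
  have hK₁0 : 0 ≤ K₁ := by positivity
  have hK₂0 : 0 ≤ K₂ := by
    have : 0 ≤ 1 - ρ := by linarith
    positivity
  have hη0 : 0 ≤ η := le_trans (by positivity) hη.le
  rcases le_or_gt ((adjMaps H G).card : ℝ) (n ^ h / (h : ℝ) ^ h) with hE | hE
  · refine hE.trans (le_mul_of_one_le_right (by positivity) (by linarith))
  obtain ⟨p₀, hp₀, hb₀⟩ := exists_partition hQ (by omega) hE hl hl1 hg hg1 hll hgj
  rw [← hn] at hb₀
  have hb₀' : (((Finset.univ : Finset (V × V)).filter fun d => Bad H G p₀ d.1 d.2).card : ℝ) ≤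
      β₀ * n ^ 2 := hb₀.trans (by gcongr)
  -- The misplaced vertices. By Markov's inequality and `β₀ ≤ r * ρ` there are at most `r * n` of
  -- them.
  set R := Finset.univ.filter fun v =>
    ρ * n < ((Finset.univ.filter fun u => Bad H G p₀ v u).card : ℝ) with hR
  set D : ℝ := n ^ (h - 1) / (h : ℝ) ^ h with hD
  have hnpos : 0 < n := by
    rcases hn0.eq_or_lt with h0 | h0
    · exfalso
      have h1 : IsEmpty V := Fintype.card_eq_zero_iff.1 (by exact_mod_cast (hn.symm.trans h0.symm))
      have h2 : adjMaps H G = ∅ :=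
        Finset.eq_empty_of_forall_notMem fun φ _ => h1.elim (φ ⟨0, hh0⟩)
      rw [h2, Finset.card_empty, Nat.cast_zero] at hE
      exact absurd hE (not_lt.2 (by positivity))
    · exact h0
  have hRc : (R.card : ℝ) ≤ r * n := by
    have h1 : (R.card : ℝ) * (ρ * n) ≤ β₀ * n ^ 2 := by
      refine le_trans ?_ hb₀'
      rw [← nsmul_eq_mul]
      refine (Finset.card_nsmul_le_sum R (fun v =>
        ((Finset.univ.filter fun u => Bad H G p₀ v u).card : ℝ)) _
        fun v hv => (Finset.mem_filter.1 hv).2.le).trans ?_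
      rw [← Nat.cast_sum, ← Finset.card_sigma]
      refine Nat.cast_le.2 (Finset.card_le_card_of_injOn (fun d => (d.1, d.2)) ?_ ?_)
      · rintro ⟨u, w⟩ hd
        simpa using (Finset.mem_filter.1 (Finset.mem_sigma.1 hd).2).2
      · rintro ⟨u, w⟩ _ ⟨u', w'⟩ _ he
        simp only [Prod.mk.injEq] at he
        obtain ⟨rfl, rfl⟩ := he
        rfl
    have h2 : (R.card : ℝ) * (ρ * n) ≤ (r * n) * (ρ * n) := by
      refine h1.trans ?_
      have := mul_le_mul_of_nonneg_right hβr (sq_nonneg n)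
      linarith
    exact le_of_mul_le_mul_right h2 (by positivity)
  have hp₀α : ∀ i, ((Finset.univ.filter fun v => p₀ v = i).card : ℝ) ≤ α * n := fun i =>
    (hp₀ i).trans (mul_le_mul_of_nonneg_right (by linarith) hn0)
  have hex : ∀ v, ∃ x, (((adjMaps H G).filter fun φ => ∃ x, φ x = v).card : ℝ) ≤ η * D ∨
      ((Finset.univ.filter fun u => p₀ u ≠ x ∧ ¬ (G.Adj v u ↔ H.Adj x (p₀ u))).card : ℝ) ≤
        ρ * n := by
    intro v
    rcases le_total (((adjMaps H G).filter fun φ => ∃ x, φ x = v).card : ℝ) (η * D) with hv | hv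
    · exact ⟨⟨0, hh0⟩, Or.inl hv⟩
    · obtain ⟨x, hx⟩ := exists_fitting_part hH hh hQ hα0 hα1 hβ0 hM hμ hρ.le (by linarith) hp₀α
        (hb₀'.trans (mul_le_mul_of_nonneg_right (by linarith) (sq_nonneg n))) hk hτ hf ht ht1 hη hv
      exact ⟨x, Or.inr hx⟩
  choose x hx using hex
  -- Each misplaced vertex moves to a part that it fits, or to an arbitrary one if few maps use it.
  let p : V → Fin h := fun v => if v ∈ R then x v else p₀ v
  have hpR : ∀ v ∉ R, p v = p₀ v := fun v hv => if_neg hv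
  -- One `ρ` is the fit with respect to `p₀`; the other covers the moved vertices, as `r ≤ ρ`.
  have hfit : ∀ v, ((Finset.univ.filter fun u => Bad H G p v u).card : ℝ) ≤ 2 * ρ * n ∨
      (((adjMaps H G).filter fun φ => ∃ x, φ x = v).card : ℝ) ≤ η * D := by
    intro v
    by_cases hv : (((adjMaps H G).filter fun φ => ∃ x, φ x = v).card : ℝ) ≤ η * D
    · exact Or.inr hv
    left
    have h1 : ((Finset.univ.filter fun u => p₀ u ≠ p v ∧
        ¬ (G.Adj v u ↔ H.Adj (p v) (p₀ u))).card : ℝ) ≤ ρ * n := by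
      by_cases hvR : v ∈ R
      · have h2 : p v = x v := if_pos hvR
        rw [h2]
        exact (hx v).resolve_left hv
      · rw [hpR v hvR]
        have h2 : ¬ (ρ * n < ((Finset.univ.filter fun u => Bad H G p₀ v u).card : ℝ)) :=
          fun hlt => hvR (Finset.mem_filter.2 ⟨Finset.mem_univ _, hlt⟩)
        refine le_trans (Nat.cast_le.2 (Finset.card_le_card fun u hu => ?_)) (not_lt.1 h2)
        have h3 := (Finset.mem_filter.1 hu).2
        exact Finset.mem_filter.2 ⟨Finset.mem_univ _, Ne.symm h3.1, h3.2⟩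
    have h2 : (Finset.univ.filter fun u => Bad H G p v u) ⊆ (Finset.univ.filter fun u =>
        p₀ u ≠ p v ∧ ¬ (G.Adj v u ↔ H.Adj (p v) (p₀ u))) ∪ R := by
      intro u hu
      by_cases huR : u ∈ R
      · exact Finset.mem_union_right _ huR
      · have h3 := (Finset.mem_filter.1 hu).2
        rw [Bad, hpR u huR] at h3
        exact Finset.mem_union_left _ (Finset.mem_filter.2
          ⟨Finset.mem_univ _, Ne.symm h3.1, h3.2⟩)
    have h3 : ((Finset.univ.filter fun u => Bad H G p v u).card : ℝ) ≤ ((Finset.univ.filter fun u =>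
        p₀ u ≠ p v ∧ ¬ (G.Adj v u ↔ H.Adj (p v) (p₀ u))).card : ℝ) + R.card := by
      exact_mod_cast (Finset.card_le_card h2).trans (Finset.card_union_le _ _)
    have h4 : r * n ≤ ρ * n := mul_le_mul_of_nonneg_right hrρ hn0
    linarith
  have hp : ∀ i, ((Finset.univ.filter fun v => p v = i).card : ℝ) ≤ α * n := by
    intro i
    have h1 : (Finset.univ.filter fun v => p v = i) ⊆
        (Finset.univ.filter fun v => p₀ v = i) ∪ R := by
      intro v hv
      by_cases hvR : v ∈ R
      · exact Finset.mem_union_right _ hvR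
      · have h2 := (Finset.mem_filter.1 hv).2
        rw [hpR v hvR] at h2
        exact Finset.mem_union_left _ (Finset.mem_filter.2 ⟨Finset.mem_univ _, h2⟩)
    have h2 : ((Finset.univ.filter fun v => p v = i).card : ℝ) ≤
        ((Finset.univ.filter fun v => p₀ v = i).card : ℝ) + R.card := by
      exact_mod_cast (Finset.card_le_card h1).trans (Finset.card_union_le _ _)
    have h3 := hp₀ i
    have h4 := mul_le_mul_of_nonneg_right hα hn0
    linarith
  have hb : (((Finset.univ : Finset (V × V)).filter fun d => Bad H G p d.1 d.2).card : ℝ) ≤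
      β * n ^ 2 := by
    have h1 : ((Finset.univ : Finset (V × V)).filter fun d => Bad H G p d.1 d.2) ⊆
        ((Finset.univ : Finset (V × V)).filter fun d => Bad H G p₀ d.1 d.2) ∪
        (R ×ˢ Finset.univ ∪ Finset.univ ×ˢ R) := by
      rintro ⟨u, v⟩ hd
      by_cases hu : u ∈ R
      · simp [hu]
      by_cases hv : v ∈ R
      · simp [hv]
      have h2 := (Finset.mem_filter.1 hd).2
      simp only [Bad, hpR u hu, hpR v hv] at h2
      exact Finset.mem_union_left _ (Finset.mem_filter.2 ⟨Finset.mem_univ _, h2⟩)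
    have h2 := (Finset.card_le_card h1).trans ((Finset.card_union_le _ _).trans
      (Nat.add_le_add_left (Finset.card_union_le _ _) _))
    rw [Finset.card_product, Finset.card_product, Finset.card_univ] at h2
    have h3 : (((Finset.univ : Finset (V × V)).filter fun d => Bad H G p d.1 d.2).card : ℝ) ≤ _ :=
      Nat.cast_le.2 h2
    push_cast at h3
    rw [← hn] at h3
    have h4 : (R.card : ℝ) * n ≤ r * n * n := mul_le_mul_of_nonneg_right hRc hn0
    have h5 := mul_le_mul_of_nonneg_right hβ (sq_nonneg n)
    linarith
  refine (card_adjMaps_le_of_partition hH hh hQ hα0 hα1 hβ0 hM hμ (by positivity) hρ1 hη0 hp hb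
    hfit hk hτ hf ht (by omega) hf').trans ?_
  rw [← hn, ← hK₀, ← hK₁]
  refine mul_le_mul_of_nonneg_left ?_ (by positivity)
  -- The three `η` come from the rarely used vertices, from `K₀ + K₁`, and from the misplaced
  -- images.
  have h1 : 1 * (K₀ + K₁ + K₂) ≤ h * (K₀ + K₁ + K₂) :=
    mul_le_mul_of_nonneg_right (by linarith only [hh1]) (by positivity)
  linarith only [h1, hη, hη', hK₂0]

end

/-! ### Numerical estimates in powers of `x = h ^ (1/100)` -/

section
open scoped Classical

theorem one_sub_pow_le_exp {a b : ℝ} (ha : a ≤ 1) {m : ℕ} (hb : b ≤ a * m) :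
    (1 - a) ^ m ≤ Real.exp (-b) := by
  calc (1 - a) ^ m ≤ (Real.exp (-a)) ^ m := by
        have h0 : 0 ≤ 1 - a := by linarith
        gcongr
        linarith [Real.add_one_le_exp (-a)]
    _ = Real.exp (m * -a) := by rw [← Real.exp_nat_mul]
    _ ≤ _ := Real.exp_le_exp.2 (by linarith)

theorem pow_le_exp_of_le {a c : ℝ} (ha : 0 ≤ a) (hac : a ≤ Real.exp c) {m : ℕ} {b : ℝ}
    (hb : m * c ≤ b) : a ^ m ≤ Real.exp b :=
  calc a ^ m ≤ (Real.exp c) ^ m := by gcongr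
    _ = Real.exp (m * c) := by rw [← Real.exp_nat_mul]
    _ ≤ _ := Real.exp_le_exp.2 hb

/-- Makes distinct powers of `x` so far apart that comparisons of exponents become linear
arithmetic. -/
theorem mul_pow_le_pow {x : ℝ} (hx : 10 ^ 6 ≤ x) {a b : ℕ} (hab : a < b) :
    10 ^ 6 * x ^ a ≤ x ^ b := by
  have hx1 : 1 ≤ x := by linarith
  calc 10 ^ 6 * x ^ a ≤ x * x ^ a := by gcongr
    _ = x ^ (a + 1) := by ring
    _ ≤ x ^ b := pow_le_pow_right₀ hx1 hab

theorem two_div_pow_le_exp {x : ℝ} (hx : 10 ^ 6 ≤ x) (a : ℕ) :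
    2 / x ^ (a + 1) ≤ Real.exp (-a) := by
  have hx0 : 0 < x := by linarith
  have hexp1 : Real.exp 1 < 3 := Real.exp_one_lt_three
  rw [div_le_iff₀ (pow_pos hx0 _), Real.exp_neg, ← div_eq_inv_mul, le_div_iff₀ (Real.exp_pos _)]
  calc 2 * Real.exp a ≤ x * x ^ a := by
        gcongr
        · linarith
        · rw [← mul_one (a : ℝ), Real.exp_nat_mul]
          gcongr
          linarith
    _ = _ := by ring

/-- The base is `6 * e ^ 2 / x ^ 5 ≤ e⁻¹`, since `200 - 25 - 180 = -5`; with `k` about `x ^ 80 /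
16`, its power beats `e ^ (5 * x ^ 2)`. -/
theorem manyMismatches_bound {x : ℝ} {h q k : ℕ} (hx : 10 ^ 6 ≤ x)
    (hxh : (h : ℝ) = x ^ 100) (hhx : (h : ℝ) ≤ Real.exp x)
    (hQ1 : (Real.exp 1 * h) ^ (q + 1) ≤ Real.exp (5 * x ^ 2))
    (hk2 : x ^ 80 / 16 - 1 ≤ k) :
    h * ((Real.exp 1 * h) ^ (q + 1) *
      ((Real.exp 1 * h) ^ 2 * (3 / x ^ 25) / (x ^ 180 / 2)) ^ k) ≤ Real.exp (-x ^ 36) := by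
  have hx0 : 0 < x := by linarith
  have hx1' := pow_one x
  have hx0' := pow_zero x
  have hexp1 : Real.exp 1 < 3 := Real.exp_one_lt_three
  have hexp1' : 0 < Real.exp 1 := Real.exp_pos 1
  have p1 := mul_pow_le_pow hx (show 0 < 1 by norm_num)
  have p2 := mul_pow_le_pow hx (show 1 < 2 by norm_num)
  have q2 := mul_pow_le_pow hx (show 0 < 80 by norm_num)
  have q6 := mul_pow_le_pow hx (show 2 < 36 by norm_num)
  have q7 := mul_pow_le_pow hx (show 36 < 80 by norm_num)
  have h1 : (Real.exp 1 * h) ^ 2 * (3 / x ^ 25) / (x ^ 180 / 2) ≤ Real.exp (-1) := by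
    have h2 : (Real.exp 1 * h) ^ 2 * (3 / x ^ 25) / (x ^ 180 / 2) =
        6 * Real.exp 1 ^ 2 / x ^ 5 := by
      rw [hxh]
      field_simp
      norm_num
    rw [h2, div_le_iff₀ (pow_pos hx0 _), Real.exp_neg, ← div_eq_inv_mul, le_div_iff₀ hexp1']
    have h3 : Real.exp 1 ^ 3 ≤ 27 := by
      calc Real.exp 1 ^ 3 ≤ 3 ^ 3 := by gcongr
        _ = 27 := by norm_num
    have h4 := mul_pow_le_pow hx (show 0 < 5 by norm_num)
    nlinarith
  have h2 : ((Real.exp 1 * h) ^ 2 * (3 / x ^ 25) / (x ^ 180 / 2)) ^ k ≤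
      Real.exp (-x ^ 80 / 32) :=
    pow_le_exp_of_le (by positivity) h1 (by linarith)
  calc _ ≤ Real.exp x * (Real.exp (5 * x ^ 2) * Real.exp (-x ^ 80 / 32)) := by gcongr
    _ = Real.exp (x + (5 * x ^ 2 + -x ^ 80 / 32)) := by rw [Real.exp_add, Real.exp_add]
    _ ≤ _ := Real.exp_le_exp.2 (by linarith)

/-- Here `2 / x ^ 25 ≤ e ^ (-24)` and `f` is about `0.6 * h`, so the power is below `e ^ (-12 * h)`,
while `4 ^ h ≤ e ^ (2 * h)`. -/
theorem largeFiber_bound {x : ℝ} {h q f : ℕ} (hx : 10 ^ 6 ≤ x)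
    (hxh : (h : ℝ) = x ^ 100) (hhx : (h : ℝ) ≤ Real.exp x)
    (hQ1 : (Real.exp 1 * h) ^ (q + 1) ≤ Real.exp (5 * x ^ 2))
    (hf2 : 6 / 10 * x ^ 100 - 1 ≤ f) :
    h * (h * 4 ^ h * (2 / x ^ 25) ^ f * (Real.exp 1 * h) ^ (q + 1)) ≤
      Real.exp (-x ^ 36) := by
  have hx0 : 0 < x := by linarith
  have hx1' := pow_one x
  have hx0' := pow_zero x
  have p1 := mul_pow_le_pow hx (show 0 < 1 by norm_num)
  have p2 := mul_pow_le_pow hx (show 1 < 2 by norm_num)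
  have q2 := mul_pow_le_pow hx (show 0 < 100 by norm_num)
  have q6 := mul_pow_le_pow hx (show 2 < 36 by norm_num)
  have q7 := mul_pow_le_pow hx (show 36 < 100 by norm_num)
  have h1 : (2 / x ^ 25) ^ f ≤ Real.exp (-12 * x ^ 100) :=
    pow_le_exp_of_le (by positivity) (two_div_pow_le_exp hx 24) (by push_cast; linarith)
  have h2 : (4 : ℝ) ^ h ≤ Real.exp (2 * x ^ 100) := by
    refine pow_le_exp_of_le (c := 2) (by norm_num) ?_ (by rw [hxh]; linarith)
    have h3 : (2 : ℝ) ≤ Real.exp 1 := by linarith [Real.add_one_le_exp (1 : ℝ)]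
    have h4 : Real.exp 2 = Real.exp 1 * Real.exp 1 := by rw [← Real.exp_add]; norm_num
    nlinarith
  calc _ ≤ Real.exp x * (Real.exp x * Real.exp (2 * x ^ 100) * Real.exp (-12 * x ^ 100) *
        Real.exp (5 * x ^ 2)) := by gcongr
    _ = Real.exp (x + (x + 2 * x ^ 100 + -12 * x ^ 100 + 5 * x ^ 2)) := by
        rw [Real.exp_add x, Real.exp_add (x + _ + _), Real.exp_add (x + _), Real.exp_add x]
    _ ≤ _ := Real.exp_le_exp.2 (by linarith)

/-- Choosing and fixing the displaced positions costs `e ^ (54 * x ^ 81)`, whereas avoiding a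
fraction `x ^ (-10)` of the vertices gains `e ^ (-x ^ 90 / 2)`. -/
theorem nearId_bound {x : ℝ} {h t : ℕ} (hx : 10 ^ 6 ≤ x)
    (hxh : (h : ℝ) = x ^ 100) (he : Real.exp 1 * h ≤ Real.exp x) (hhx : (h : ℝ) ≤ Real.exp x)
    (hh1x : (h : ℝ) + 1 ≤ Real.exp x)
    (ht2 : (t : ℝ) ≤ 25 * x ^ 80 + 1) (hth : t + 1 ≤ h) :
    h * ((h + 1) ^ (t + 1) * (Real.exp 1 * h) ^ (t + 1) *
      (1 - 1 / x ^ 10) ^ (h - (t + 1))) ≤ Real.exp (-x ^ 36) := by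
  have hx0 : 0 < x := by linarith
  have hx1' := pow_one x
  have hx0' := pow_zero x
  have hinv1 : 1 / x ^ 10 ≤ 1 := by
    rw [div_le_one (pow_pos hx0 _)]
    exact one_le_pow₀ (by linarith)
  have p1 := mul_pow_le_pow hx (show 0 < 1 by norm_num)
  have p2 := mul_pow_le_pow hx (show 1 < 2 by norm_num)
  have q2 := mul_pow_le_pow hx (show 0 < 80 by norm_num)
  have q3 := mul_pow_le_pow hx (show 80 < 81 by norm_num)
  have q4 := mul_pow_le_pow hx (show 81 < 90 by norm_num)
  have q5 := mul_pow_le_pow hx (show 90 < 100 by norm_num)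
  have q6 := mul_pow_le_pow hx (show 2 < 36 by norm_num)
  have q7 := mul_pow_le_pow hx (show 36 < 80 by norm_num)
  have hht : ((h - (t + 1) : ℕ) : ℝ) = x ^ 100 - (t + 1) := by
    rw [Nat.cast_sub hth, hxh]
    push_cast
    ring
  have hb : ((t + 1 : ℕ) : ℝ) * x ≤ 27 * x ^ 81 := by
    have h1 : ((t + 1 : ℕ) : ℝ) ≤ 27 * x ^ 80 := by push_cast; linarith
    calc ((t + 1 : ℕ) : ℝ) * x ≤ 27 * x ^ 80 * x := by gcongr
      _ = _ := by ring
  have h1 : ((h : ℝ) + 1) ^ (t + 1) ≤ Real.exp (27 * x ^ 81) :=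
    pow_le_exp_of_le (by positivity) hh1x hb
  have h2 : (Real.exp 1 * h) ^ (t + 1) ≤ Real.exp (27 * x ^ 81) :=
    pow_le_exp_of_le (by positivity) he hb
  have h3 : (1 - 1 / x ^ 10) ^ (h - (t + 1)) ≤ Real.exp (-(x ^ 90 / 2)) := by
    refine one_sub_pow_le_exp (hinv1) ?_
    have hx90 : 1 / x ^ 10 * x ^ (10 + 90) = x ^ 90 := by
      rw [pow_add]
      field_simp
    rw [hht, ← hx90]
    have : 1 / x ^ 10 * x ^ (10 + 90) / 2 = 1 / x ^ 10 * (x ^ 100 / 2) := by ring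
    rw [this]
    gcongr
    linarith
  have h4 : 0 ≤ 1 - 1 / x ^ 10 := by linarith [hinv1]
  calc _ ≤ Real.exp x * (Real.exp (27 * x ^ 81) * Real.exp (27 * x ^ 81) *
        Real.exp (-(x ^ 90 / 2))) := by gcongr
    _ = Real.exp (x + (27 * x ^ 81 + 27 * x ^ 81 + -(x ^ 90 / 2))) := by
        rw [Real.exp_add x, Real.exp_add (_ + _), Real.exp_add (27 * x ^ 81)]
    _ ≤ _ := Real.exp_le_exp.2 (by linarith)

/-- The gain `(2 / x ^ 10) ^ f' ≤ e ^ (-3 * h)` beats `2 ^ h ≤ e ^ h` and the cost `e ^ (54 * x ^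
81)` of the displaced positions. -/
theorem misplaced_bound {x : ℝ} {h t f' : ℕ} (hx : 10 ^ 6 ≤ x)
    (hxh : (h : ℝ) = x ^ 100) (he : Real.exp 1 * h ≤ Real.exp x) (hhx : (h : ℝ) ≤ Real.exp x)
    (hh1x : (h : ℝ) + 1 ≤ Real.exp x)
    (ht2 : (t : ℝ) ≤ 25 * x ^ 80 + 1) (hf'2 : 4 / 10 * x ^ 100 - 1 ≤ f') :
    h * ((h + 1) ^ t * (Real.exp 1 * h) ^ t * (2 ^ h * (2 * (1 / x ^ 10)) ^ f')) ≤
      Real.exp (-x ^ 36) := by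
  have hx0 : 0 < x := by linarith
  have hx1' := pow_one x
  have hx0' := pow_zero x
  have p1 := mul_pow_le_pow hx (show 0 < 1 by norm_num)
  have p2 := mul_pow_le_pow hx (show 1 < 2 by norm_num)
  have q2 := mul_pow_le_pow hx (show 0 < 80 by norm_num)
  have q3 := mul_pow_le_pow hx (show 80 < 81 by norm_num)
  have q5 := mul_pow_le_pow hx (show 81 < 100 by norm_num)
  have q6 := mul_pow_le_pow hx (show 2 < 36 by norm_num)
  have q7 := mul_pow_le_pow hx (show 36 < 80 by norm_num)
  have hb : (t : ℝ) * x ≤ 27 * x ^ 81 := by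
    have h1 : (t : ℝ) ≤ 27 * x ^ 80 := by linarith
    calc (t : ℝ) * x ≤ 27 * x ^ 80 * x := by gcongr
      _ = _ := by ring
  have h1 : ((h : ℝ) + 1) ^ t ≤ Real.exp (27 * x ^ 81) :=
    pow_le_exp_of_le (by positivity) hh1x hb
  have h2 : (Real.exp 1 * h) ^ t ≤ Real.exp (27 * x ^ 81) :=
    pow_le_exp_of_le (by positivity) he hb
  have h3 : (2 * (1 / x ^ 10)) ^ f' ≤ Real.exp (-3 * x ^ 100) := by
    rw [← mul_div_assoc, mul_one]
    exact pow_le_exp_of_le (by positivity) (two_div_pow_le_exp hx 9) (by push_cast; linarith)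
  have h4 : (2 : ℝ) ^ h ≤ Real.exp (x ^ 100) := by
    refine pow_le_exp_of_le (c := 1) (by norm_num) ?_ (by rw [hxh]; linarith)
    linarith [Real.add_one_le_exp (1 : ℝ)]
  calc _ ≤ Real.exp x * (Real.exp (27 * x ^ 81) * Real.exp (27 * x ^ 81) *
        (Real.exp (x ^ 100) * Real.exp (-3 * x ^ 100))) := by gcongr
    _ = Real.exp (x + (27 * x ^ 81 + 27 * x ^ 81 + (x ^ 100 + -3 * x ^ 100))) := by
        rw [Real.exp_add x, Real.exp_add (_ + _), Real.exp_add (27 * x ^ 81),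
          Real.exp_add (x ^ 100)]
    _ ≤ _ := Real.exp_le_exp.2 (by linarith)

variable {h : ℕ} {V : Type*} [Fintype V]
  {H : SimpleGraph (Fin h)} {G : SimpleGraph V} {Q : Finset (Fin h)}

set_option maxHeartbeats 400000 in
/-- The number of induced copies of a strongly asymmetric graph on `x ^ 100` vertices. -/
theorem card_adjMaps_le (hH : StronglyAsymmetric H)
    (hQ : IsDistinguishing H (Q : Set (Fin h))) {x η : ℝ} (hx : 10 ^ 6 ≤ x)
    (hxh : (h : ℝ) = x ^ 100) (he : Real.exp 1 * h ≤ Real.exp x) (hq : (Q.card + 1 : ℝ) ≤ 5 * x)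
    (hη : Real.exp (-x ^ 35) ≤ η) :
    ((adjMaps H G).card : ℝ) ≤ (Fintype.card V : ℝ) ^ h / (h : ℝ) ^ h * (1 + 3 * η) := by
  have hx0 : 0 < x := by linarith
  have hx1 : 1 ≤ x := by linarith
  have hxx : ∀ a b : ℕ, a < b → 10 ^ 6 * x ^ a ≤ x ^ b := fun _ _ => mul_pow_le_pow hx
  have hpos : ∀ a : ℕ, 0 < x ^ a := fun a => pow_pos hx0 a
  have hx1' := pow_one x
  have hx0' := pow_zero x
  have p1 := hxx 0 1 (by norm_num)
  have p2 := hxx 1 2 (by norm_num)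
  have p3 := hxx 2 3 (by norm_num)
  have p4 := hxx 2 5 (by norm_num)
  have hexp1 : Real.exp 1 < 3 := Real.exp_one_lt_three
  have hexp1' : 0 < Real.exp 1 := Real.exp_pos 1
  have hhpos : (0 : ℝ) < h := by rw [hxh]; positivity
  have hh1000 : 1000 ≤ h := by
    have h1 := hxx 0 100 (by norm_num)
    have : (1000 : ℝ) ≤ h := by rw [hxh]; linarith
    exact_mod_cast this
  have he1 : 1 ≤ Real.exp 1 * h := one_le_exp_mul (by omega)
  have hhx : (h : ℝ) ≤ Real.exp x := by
    refine le_trans ?_ he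
    nlinarith [Real.add_one_le_exp (1 : ℝ)]
  have hh1x : (h : ℝ) + 1 ≤ Real.exp x := by
    refine le_trans ?_ he
    have : (1000 : ℝ) ≤ h := by exact_mod_cast hh1000
    nlinarith [Real.add_one_le_exp (1 : ℝ)]
  have hQ1 : (Real.exp 1 * h) ^ (Q.card + 1) ≤ Real.exp (5 * x ^ 2) := by
    refine pow_le_exp_of_le (by positivity) he ?_
    push_cast
    linarith only [mul_le_mul_of_nonneg_right hq hx0.le]
  have hQ0 : (Real.exp 1 * h) ^ Q.card ≤ Real.exp (5 * x ^ 2) :=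
    (pow_le_pow_right₀ he1 (by omega)).trans hQ1
  have q1 := hxx 1 100 (by norm_num)
  have hQh2 : Q.card + 1 ≤ h := by
    have : (Q.card + 1 : ℝ) ≤ h := by rw [hxh]; linarith
    exact_mod_cast this
  -- the rounded parameters
  obtain ⟨j, hj1, hj2⟩ : ∃ j : ℕ, x ^ 50 ≤ j ∧ (j : ℝ) ≤ x ^ 50 + 1 :=
    ⟨_, Nat.le_ceil _, (Nat.ceil_lt_add_one (hpos 50).le).le⟩
  obtain ⟨k, hk1, hk2⟩ : ∃ k : ℕ, (k : ℝ) ≤ x ^ 80 / 16 ∧ x ^ 80 / 16 - 1 ≤ k :=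
    ⟨_, Nat.floor_le (by positivity), (Nat.sub_one_lt_floor _).le⟩
  obtain ⟨t, ht1, ht2⟩ : ∃ t : ℕ, 25 * x ^ 80 ≤ t ∧ (t : ℝ) ≤ 25 * x ^ 80 + 1 :=
    ⟨_, Nat.le_ceil _, (Nat.ceil_lt_add_one (by positivity)).le⟩
  obtain ⟨f, hf1, hf2⟩ : ∃ f : ℕ, (f : ℝ) ≤ 6 / 10 * x ^ 100 ∧ 6 / 10 * x ^ 100 - 1 ≤ f :=
    ⟨_, Nat.floor_le (by positivity), (Nat.sub_one_lt_floor _).le⟩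
  obtain ⟨f', hf'1, hf'2⟩ : ∃ f : ℕ, (f : ℝ) ≤ 4 / 10 * x ^ 100 ∧ 4 / 10 * x ^ 100 - 1 ≤ f :=
    ⟨_, Nat.floor_le (by positivity), (Nat.sub_one_lt_floor _).le⟩
  have q2 := hxx 0 80 (by norm_num)
  have q3 := hxx 80 81 (by norm_num)
  have q4 := hxx 81 90 (by norm_num)
  have q5 := hxx 90 100 (by norm_num)
  have q6 := hxx 2 36 (by norm_num)
  have q7 := hxx 36 80 (by norm_num)
  have q8 := hxx 35 36 (by norm_num)
  have q9 := hxx 0 35 (by norm_num)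
  have hth : t + 1 ≤ h := by
    have : (t + 1 : ℝ) ≤ h := by rw [hxh]; linarith
    exact_mod_cast this
  have hxinv : ∀ a b : ℕ, 1 / x ^ a * x ^ (a + b) = x ^ b := by
    intro a b
    rw [pow_add]
    field_simp
  have hinv1 : ∀ a : ℕ, 1 / x ^ a ≤ 1 := fun a => by
    rw [div_le_one (hpos a)]
    exact one_le_pow₀ hx1
  have hsmall : ∀ a : ℕ, 0 < a → 1 / x ^ a ≤ 1 / 10 ^ 6 := fun a ha => by
    refine one_div_le_one_div_of_le (by norm_num) ?_
    have := hxx 0 a ha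
    linarith
  have hsum3 : Real.exp (-x ^ 36) * 3 < η := by
    refine lt_of_lt_of_le ?_ hη
    have h1 : (3 : ℝ) < Real.exp 2 := by
      nlinarith [Real.add_one_le_exp (2 : ℝ), Real.add_one_lt_exp (two_ne_zero : (2 : ℝ) ≠ 0)]
    calc Real.exp (-x ^ 36) * 3 < Real.exp (-x ^ 36) * Real.exp 2 :=
          mul_lt_mul_of_pos_left h1 (Real.exp_pos _)
      _ = Real.exp (-x ^ 36 + 2) := by rw [Real.exp_add]
      _ ≤ _ := Real.exp_le_exp.2 (by linarith)
  have hK₀ := manyMismatches_bound hx hxh hhx hQ1 hk2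
  have hK₁ := largeFiber_bound hx hxh hhx hQ1 hf2
  have hK₂ := nearId_bound hx hxh he hhx hh1x ht2 hth
  have hK₃ := misplaced_bound hx hxh he hhx hh1x ht2 hf'2
  have hrel : ∀ a b : ℕ, 1 / x ^ (a + b) = 1 / x ^ a * (1 / x ^ b) := fun a b => by
    rw [pow_add]
    field_simp
  have r2 : 1 / x ^ 97 ≤ 1 / x ^ 35 * (1 / 10 ^ 6) := by
    rw [hrel 35 62]
    exact mul_le_mul_of_nonneg_left (hsmall 62 (by norm_num)) (by positivity)
  have r3 : 1 / x ^ 39 ≤ 1 / x ^ 35 * (1 / 10 ^ 6) := by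
    rw [hrel 35 4]
    exact mul_le_mul_of_nonneg_left (hsmall 4 (by norm_num)) (by positivity)
  have r4 : 1 / x ^ 44 ≤ 1 / x ^ 35 * (1 / 10 ^ 6) := by
    rw [hrel 35 9]
    exact mul_le_mul_of_nonneg_left (hsmall 9 (by norm_num)) (by positivity)
  have r5 : 1 / x ^ 35 ≤ 1 / x ^ 25 * (1 / 10 ^ 6) := by
    rw [hrel 25 10]
    exact mul_le_mul_of_nonneg_left (hsmall 10 (by norm_num)) (by positivity)
  have r6 : 1 / x ^ 25 ≤ 1 / x ^ 10 * (1 / 10 ^ 6) := by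
    rw [hrel 10 15]
    exact mul_le_mul_of_nonneg_left (hsmall 15 (by norm_num)) (by positivity)
  have s0 : ∀ a : ℕ, 0 < 1 / x ^ a := fun a => one_div_pos.2 (hpos a)
  -- With `h = x ^ 100`: `l * h = x ^ 3` and `g * j ≥ x ^ 5` both beat the exponent `5 * x ^ 2` paid
  -- for `Q`; `g * h ^ 2 * l ^ 2 = x ^ (-39)` and `h * j * l ^ 2`, about `x ^ (-44)`, fit below `β₀
  -- = x ^ (-35)`; `r = β₀ / ρ`; `μ * h ^ 2 = x ^ 180 = 2 * M`; and `t` is about `25 * μ * h`.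
  refine card_adjMaps_le_of_parameters hH hh1000 hQ (l := 1 / x ^ 97) (g := 1 / x ^ 45)
    (r := 1 / x ^ 25) (α := 2 / x ^ 25) (β₀ := 1 / x ^ 35) (β := 3 / x ^ 25) (M := x ^ 180 / 2)
    (μ := 1 / x ^ 20) (ρ := 1 / x ^ 10) (j := j) (k := k) (f := f) (f' := f') (t := t)
    (s0 97) (hinv1 97) (s0 45).le (hinv1 45) ?_ (by positivity) (hsmall 20 (by norm_num)) (s0 10)
    ?_ (s0 25).le ?_ ?_ ?_ ?_ ?_ ?_ ?_ ?_ ?_ ?_ ?_ ?_ ?_ ?_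
  · have : 2 / x ^ 25 = 2 * (1 / x ^ 25) := by ring
    linarith [hsmall 25 (by norm_num)]
  · linarith [hsmall 10 (by norm_num)]
  · have h1 : (1 - 1 / x ^ 97) ^ (h - Q.card - 1) ≤ Real.exp (-(x ^ 3 / 2)) := by
      refine one_sub_pow_le_exp (hinv1 97) ?_
      rw [← hxinv 97 3, Nat.sub_sub, Nat.cast_sub hQh2, hxh]
      have : 1 / x ^ 97 * x ^ (97 + 3) / 2 = 1 / x ^ 97 * (x ^ 100 / 2) := by ring
      rw [this]
      gcongr
      push_cast
      linarith
    have h2 : 0 ≤ 1 - 1 / x ^ 97 := by linarith [hinv1 97]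
    calc _ ≤ Real.exp (-(x ^ 3 / 2)) * Real.exp (5 * x ^ 2) := by gcongr
      _ = Real.exp (-(x ^ 3 / 2) + 5 * x ^ 2) := by rw [Real.exp_add]
      _ < 1 := Real.exp_lt_one_iff.2 (by linarith only [p3, p4, hpos 2])
  · have h1 : (1 - 1 / x ^ 45) ^ j ≤ Real.exp (-(x ^ 5)) := by
      refine one_sub_pow_le_exp (hinv1 45) ?_
      rw [← hxinv 45 5]
      gcongr
    have h2 : 0 ≤ 1 - 1 / x ^ 45 := by linarith [hinv1 45]
    calc _ ≤ Real.exp (-(x ^ 5)) * Real.exp (5 * x ^ 2) := by gcongr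
      _ = Real.exp (-(x ^ 5) + 5 * x ^ 2) := by rw [Real.exp_add]
      _ < 1 := Real.exp_lt_one_iff.2 (by linarith only [p3, p4, hpos 2])
  · have hj3 : (j : ℝ) ≤ 2 * x ^ 50 := by
      have := hxx 0 50 (by norm_num)
      linarith
    calc (1 / x ^ 45 * (h : ℝ) ^ 2 + 4 * h * j) * (1 / x ^ 97) ^ 2 + 2 * (1 / x ^ 97)
        ≤ (1 / x ^ 45 * (x ^ 100) ^ 2 + 4 * x ^ 100 * (2 * x ^ 50)) * (1 / x ^ 97) ^ 2 +
          2 * (1 / x ^ 97) := by rw [hxh]; gcongr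
      _ = 1 / x ^ 39 + 8 * (1 / x ^ 44) + 2 * (1 / x ^ 97) := by
          congr 1
          field_simp
          norm_num
      _ ≤ _ := by linarith [s0 35]
  · rw [← hrel 25 10]
  · linarith [s0 10]
  · have : 3 / x ^ 25 = 3 * (1 / x ^ 25) := by ring
    linarith [s0 25]
  · have : 2 / x ^ 25 = 2 * (1 / x ^ 25) := by ring
    linarith [s0 25]
  · have : (2 * k + Q.card + 1 : ℝ) ≤ h := by rw [hxh]; linarith
    exact_mod_cast this
  · have h1 : 1 / x ^ 20 * (h : ℝ) ^ 2 = x ^ 180 := by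
      rw [hxh, ← pow_mul, ← hxinv 20 180]
    have h2 : 4 * (h : ℝ) * k ≤ x ^ 180 / 4 := by
      calc 4 * (h : ℝ) * k ≤ 4 * x ^ 100 * (x ^ 80 / 16) := by rw [hxh]; gcongr
        _ = _ := by ring
    have h3 : 2 * (h : ℝ) * (Q.card + 1) ≤ 10 * x ^ 101 := by
      calc 2 * (h : ℝ) * (Q.card + 1) ≤ 2 * x ^ 100 * (5 * x) := by rw [hxh]; gcongr
        _ = _ := by ring
    have h4 := hxx 101 180 (by norm_num)
    rw [h1]
    linarith [hpos 101]
  · rw [hxh]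
    linarith
  · have h1 : 25 * (1 / x ^ 20) * (h : ℝ) = 25 * x ^ 80 := by
      rw [hxh, ← hxinv 20 80]
      ring
    rw [h1]
    exact ht1
  · rw [hxh]
    linarith
  · rw [mul_add, mul_add]
    linarith
  · refine hK₃.trans ?_
    linarith [Real.exp_pos (-x ^ 36)]

end

/-! ### The limit, and the bound for the inducibility -/

section
open scoped Classical

/-- Each copy is the range of an isomorphism onto it. Maps need not be injective, which only
enlarges the right side. -/
theorem inducedCopies_le_card_adjMaps {h : ℕ} {V : Type*} [Fintype V] (H : SimpleGraph (Fin h))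
    (G : SimpleGraph V) : inducedCopies H G ≤ (adjMaps H G).card := by
  refine le_trans ?_ (Finset.card_image_le (s := adjMaps H G) (f := Set.range))
  rw [inducedCopies, ← Set.ncard_coe_finset]
  refine Set.ncard_le_ncard ?_ (Finset.finite_toSet _)
  rintro S ⟨e⟩
  rw [Finset.coe_image]
  refine ⟨fun x => (e.symm x : V), ?_, ?_⟩
  · rw [Finset.mem_coe, mem_adjMaps]
    exact fun x y => (e.symm.map_adj_iff (v := x) (w := y)).symm
  · exact (e.symm.surjective.range_comp Subtype.val).trans Subtype.range_coe

theorem inducedCopies_le_maxInducedCopies {V : Type*} (H : SimpleGraph V) {n : ℕ}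
    (G : SimpleGraph (Fin n)) : inducedCopies H G ≤ maxInducedCopies H n :=
  le_ciSup (f := fun G : SimpleGraph (Fin n) => inducedCopies H G) (Set.finite_range _).bddAbove G

theorem exists_inducedCopies_eq_maxInducedCopies {V : Type*} (H : SimpleGraph V) (n : ℕ) :
    ∃ G : SimpleGraph (Fin n), inducedCopies H G = maxInducedCopies H n :=
  exists_eq_ciSup_of_finite (f := fun G : SimpleGraph (Fin n) => inducedCopies H G)

/-- Sets in the range of an embedding induce the same graph as their preimage. -/
theorem nonempty_induce_preimage_iso {W W' : Type*} (G : SimpleGraph W) (f : W' ↪ W) {S : Set W}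
    (hS : S ⊆ Set.range f) : Nonempty ((G.comap f).induce (f ⁻¹' S) ≃g G.induce S) := by
  refine ⟨⟨Equiv.ofBijective (fun x => ⟨f x, x.2⟩) ⟨?_, ?_⟩, Iff.rfl⟩⟩
  · intro x y hxy
    exact Subtype.ext (f.injective (congrArg Subtype.val hxy))
  · rintro ⟨w, hw⟩
    obtain ⟨x, rfl⟩ := hS hw
    exact ⟨⟨x, hw⟩, rfl⟩

/-- The number of induced copies averages over the graphs obtained by deleting one vertex. -/
theorem mul_maxInducedCopies_succ_le {h : ℕ} (H : SimpleGraph (Fin h)) (n : ℕ) :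
    (n + 1 - h) * maxInducedCopies H (n + 1) ≤ (n + 1) * maxInducedCopies H n := by
  obtain ⟨G, hG⟩ := exists_inducedCopies_eq_maxInducedCopies H (n + 1)
  rw [← hG, inducedCopies]
  set 𝒮 : Finset (Set (Fin (n + 1))) :=
    (Set.toFinite {S : Set (Fin (n + 1)) | Nonempty (G.induce S ≃g H)}).toFinset with h𝒮
  have hmem : ∀ S, S ∈ 𝒮 ↔ Nonempty (G.induce S ≃g H) := fun S => by simp [h𝒮]
  have hc : {S : Set (Fin (n + 1)) | Nonempty (G.induce S ≃g H)}.ncard = 𝒮.card := by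
    rw [h𝒮, Set.ncard_eq_toFinset_card _ (Set.toFinite _)]
  have h1 : ∀ S ∈ 𝒮, (Finset.univ.filter fun v => v ∉ S).card = n + 1 - h := by
    intro S hS
    obtain ⟨e⟩ := (hmem S).1 hS
    have h2 : (Finset.univ.filter fun v => v ∈ S).card = h := by
      rw [← Fintype.card_subtype, Fintype.card_congr e.toEquiv, Fintype.card_fin]
    have h3 := Finset.card_filter_add_card_filter_not (s := Finset.univ) (fun v => v ∈ S)
    rw [h2, Finset.card_univ, Fintype.card_fin] at h3
    omega
  have h2 : ∀ v, (𝒮.filter fun S => v ∉ S).card ≤ maxInducedCopies H n := by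
    intro v
    let f : Fin n ↪ Fin (n + 1) := Fin.succAboveEmb v
    have hrange : ∀ S : Set (Fin (n + 1)), v ∉ S → S ⊆ Set.range f := by
      intro S hv w hw
      have : Set.range f = {v}ᶜ := Fin.range_succAbove v
      rw [this]
      rintro rfl
      exact hv hw
    refine le_trans ?_ (inducedCopies_le_maxInducedCopies H (G.comap f))
    rw [inducedCopies, ← Set.ncard_coe_finset]
    -- Copies avoiding `v` are copies in the graph with `v` deleted.
    refine Set.ncard_le_ncard_of_injOn (fun S => f ⁻¹' S) ?_ ?_ (Set.toFinite _)
    · intro S hS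
      obtain ⟨hS1, hv⟩ := Finset.mem_filter.1 hS
      obtain ⟨e⟩ := (hmem S).1 hS1
      obtain ⟨e'⟩ := nonempty_induce_preimage_iso G f (hrange S hv)
      exact ⟨e'.trans e⟩
    · intro S hS S' hS' he
      have hv := (Finset.mem_filter.1 hS).2
      have hv' := (Finset.mem_filter.1 hS').2
      rw [← Set.image_preimage_eq_of_subset (hrange S hv),
        ← Set.image_preimage_eq_of_subset (hrange S' hv')]
      exact congrArg _ he
  rw [hc]
  calc (n + 1 - h) * 𝒮.card = ∑ S ∈ 𝒮, (Finset.univ.filter fun v => v ∉ S).card := by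
        rw [Finset.sum_congr rfl h1, Finset.sum_const, smul_eq_mul, mul_comm]
    _ = ∑ v : Fin (n + 1), (𝒮.filter fun S => v ∉ S).card := by
        simp only [Finset.card_filter]
        exact Finset.sum_comm
    _ ≤ ∑ _v : Fin (n + 1), maxInducedCopies H n := Finset.sum_le_sum fun v _ => h2 v
    _ = _ := by simp

theorem maxInducedDensity_succ_le {h n : ℕ} (hn : h ≤ n) (H : SimpleGraph (Fin h)) :
    maxInducedDensity H (n + 1) ≤ maxInducedDensity H n := by
  have hc1 : (0 : ℝ) < n.choose h := by exact_mod_cast Nat.choose_pos hn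
  have hc2 : (0 : ℝ) < (n + 1).choose h := by exact_mod_cast Nat.choose_pos (by omega)
  have hs : (0 : ℝ) < (n + 1 - h : ℕ) := by exact_mod_cast (by omega : 0 < n + 1 - h)
  have h1 : ((n + 1 - h : ℕ) : ℝ) * maxInducedCopies H (n + 1) ≤ (n + 1) * maxInducedCopies H n := by
    exact_mod_cast mul_maxInducedCopies_succ_le H n
  have h2 : (n.choose h : ℝ) * (n + 1) = (n + 1).choose h * (n + 1 - h : ℕ) := by
    exact_mod_cast Nat.choose_mul_succ_eq n h
  rw [maxInducedDensity, maxInducedDensity, div_le_div_iff₀ hc2 hc1]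
  refine le_of_mul_le_mul_left ?_ hs
  calc ((n + 1 - h : ℕ) : ℝ) * (maxInducedCopies H (n + 1) * n.choose h)
      = ((n + 1 - h : ℕ) * maxInducedCopies H (n + 1)) * n.choose h := by ring
    _ ≤ ((n + 1) * maxInducedCopies H n) * n.choose h := by gcongr
    _ = maxInducedCopies H n * (n.choose h * (n + 1)) := by ring
    _ = _ := by rw [h2]; ring

/-- The limit defining the inducibility exists. -/
theorem tendsto_maxInducedDensity {h : ℕ} (H : SimpleGraph (Fin h)) :
    Tendsto (maxInducedDensity H) atTop (𝓝 (inducibility H)) := by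
  -- The shift by `h` matters: for `n < h` the binomial coefficient vanishes and the density takes
  -- the default value 0.
  have hanti : Antitone fun n => maxInducedDensity H (n + h) := by
    refine antitone_nat_of_succ_le fun n => ?_
    rw [show n + 1 + h = n + h + 1 by omega]
    exact maxInducedDensity_succ_le (by omega) H
  have hbdd : BddBelow (Set.range fun n => maxInducedDensity H (n + h)) := by
    refine ⟨0, ?_⟩
    rintro _ ⟨n, rfl⟩
    exact div_nonneg (Nat.cast_nonneg _) (Nat.cast_nonneg _)
  exact tendsto_nhds_limUnder
    ⟨_, (tendsto_add_atTop_iff_nat h).1 (tendsto_atTop_ciInf hanti hbdd)⟩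

/-- A bound for the number of copies gives a bound for the inducibility. -/
theorem inducibility_le_of_forall_card_adjMaps_le {h : ℕ} (H : SimpleGraph (Fin h)) {c : ℝ}
    (hc : ∀ n : ℕ, ∀ G : SimpleGraph (Fin n), ((adjMaps H G).card : ℝ) ≤ (n : ℝ) ^ h * c) :
    inducibility H ≤ h.factorial * c := by
  have hlim : Tendsto (fun n : ℕ => c / ((n.choose h : ℝ) * (1 / (n : ℝ)) ^ h)) atTop
      (𝓝 (c / (1 ^ h / h.factorial))) := by
    refine Tendsto.div tendsto_const_nhds
      (ProbabilityTheory.tendsto_choose_mul_pow_atTop h ?_) (by positivity)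
    refine tendsto_const_nhds.congr' ?_
    filter_upwards [eventually_gt_atTop 0] with n hn
    have : (n : ℝ) ≠ 0 := by exact_mod_cast hn.ne'
    field_simp
  rw [one_pow, div_div_eq_mul_div, div_one, mul_comm] at hlim
  refine le_of_tendsto_of_tendsto (tendsto_maxInducedDensity H) hlim ?_
  filter_upwards [eventually_gt_atTop 0, eventually_ge_atTop h] with n hn hnh
  have hn' : (0 : ℝ) < n := by exact_mod_cast hn
  have hch : (0 : ℝ) < n.choose h := by exact_mod_cast Nat.choose_pos hnh
  obtain ⟨G, hG⟩ := exists_inducedCopies_eq_maxInducedCopies H n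
  have h1 : (maxInducedCopies H n : ℝ) ≤ (n : ℝ) ^ h * c := by
    rw [← hG]
    exact (Nat.cast_le.2 (inducedCopies_le_card_adjMaps H G)).trans (hc n G)
  rw [maxInducedDensity, div_le_iff₀ hch]
  refine h1.trans (le_of_eq ?_)
  rw [one_div, inv_pow]
  field_simp

/-- The conditions on the size of `h` hold for large `h`. -/
theorem eventually_large : ∀ᶠ h : ℕ in atTop, (10 ^ 6 : ℝ) ≤ (h : ℝ) ^ (1 / 100 : ℝ) ∧
    1 + Real.log h ≤ (h : ℝ) ^ (1 / 100 : ℝ) := by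
  have h1 : Tendsto (fun h : ℕ => (h : ℝ) ^ (1 / 100 : ℝ)) atTop atTop :=
    (tendsto_rpow_atTop (by norm_num)).comp tendsto_natCast_atTop_atTop
  have h2 : ∀ᶠ h : ℕ in atTop, ‖Real.log h‖ ≤ 1 / 2 * ‖(h : ℝ) ^ (1 / 100 : ℝ)‖ :=
    tendsto_natCast_atTop_atTop.eventually
      ((isLittleO_log_rpow_atTop (by norm_num : (0 : ℝ) < 1 / 100)).def (by norm_num))
  filter_upwards [h1.eventually_ge_atTop (10 ^ 6), h2] with h h3 h4
  refine ⟨h3, ?_⟩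
  rw [Real.norm_of_nonneg (by positivity : (0 : ℝ) ≤ (h : ℝ) ^ (1 / 100 : ℝ))] at h4
  have := (le_abs_self _).trans h4
  linarith

/-- The upper bound for the inducibility of a large strongly asymmetric graph. -/
theorem inducibility_le {h : ℕ} {H : SimpleGraph (Fin h)} (hH : StronglyAsymmetric H)
    (h6 : (10 ^ 6 : ℝ) ≤ (h : ℝ) ^ (1 / 100 : ℝ))
    (hlog : 1 + Real.log h ≤ (h : ℝ) ^ (1 / 100 : ℝ)) :
    inducibility H ≤ ((h.factorial : ℝ) / ((h : ℝ) ^ h - h)) *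
      (1 + 4 / (h : ℝ) ^ ((h : ℝ) ^ (1 / 3 : ℝ))) := by
  set x : ℝ := (h : ℝ) ^ (1 / 100 : ℝ) with hx
  have hh0 : (0 : ℝ) ≤ h := Nat.cast_nonneg _
  have hxh : (h : ℝ) = x ^ 100 := by
    rw [hx, ← Real.rpow_natCast, ← Real.rpow_mul hh0]
    norm_num
  have hx0 : 0 < x := by linarith
  have hhpos : (0 : ℝ) < h := by rw [hxh]; positivity
  have hx1 : 1 ≤ x := by linarith
  have hlog0 : 0 ≤ Real.log h := Real.log_nonneg (by rw [hxh]; exact one_le_pow₀ hx1)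
  obtain ⟨Q, hQ, hQc⟩ := hH.distinguishing
  set Q' := (Set.toFinite Q).toFinset with hQ'
  have hQQ : (Q' : Set (Fin h)) = Q := Set.Finite.coe_toFinset _
  have hQ'c : (Q'.card : ℝ) ≤ 3 * Real.logb 2 h := by
    rw [← Set.ncard_coe_finset, hQQ]
    exact hQc
  have hq : (Q'.card + 1 : ℝ) ≤ 5 * x := by
    have h1 : Real.logb 2 h ≤ 3 / 2 * Real.log h := by
      rw [Real.logb, div_le_iff₀ (Real.log_pos one_lt_two)]
      nlinarith [Real.log_two_gt_d9]
    linarith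
  have he : Real.exp 1 * h ≤ Real.exp x := by
    calc Real.exp 1 * h = Real.exp (1 + Real.log h) := by
          rw [Real.exp_add, Real.exp_log hhpos]
      _ ≤ _ := Real.exp_le_exp.2 hlog
  set η : ℝ := 1 / (h : ℝ) ^ ((h : ℝ) ^ (1 / 3 : ℝ)) with hη
  have hη0 : 0 < η := by positivity
  -- Since `log h ≤ x` and `h ^ (1/3) ≤ x ^ 34`, the exponent `log h * h ^ (1/3)` is at most `x ^
  -- 35`.
  have hηx : Real.exp (-x ^ 35) ≤ η := by
    rw [hη, one_div, ← Real.rpow_neg hh0, Real.rpow_def_of_pos hhpos]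
    refine Real.exp_le_exp.2 ?_
    have h1 : (h : ℝ) ^ (1 / 3 : ℝ) ≤ x ^ 34 := by
      rw [hx, ← Real.rpow_natCast, ← Real.rpow_mul hh0]
      exact Real.rpow_le_rpow_of_exponent_le (by rw [hxh]; exact one_le_pow₀ hx1) (by norm_num)
    have h2 : Real.log h * (h : ℝ) ^ (1 / 3 : ℝ) ≤ x * x ^ 34 := by
      gcongr
      linarith
    have h3 : x * x ^ 34 = x ^ 35 := by ring
    linarith
  have hbound : inducibility H ≤ h.factorial * (1 / (h : ℝ) ^ h * (1 + 3 * η)) := by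
    refine inducibility_le_of_forall_card_adjMaps_le H fun n G => ?_
    have h1 := card_adjMaps_le (G := G) (Q := Q') hH (by rw [hQQ]; exact hQ) h6 hxh he hq hηx
    rw [Fintype.card_fin] at h1
    refine h1.trans (le_of_eq ?_)
    ring
  have hh2 : 2 ≤ h := by
    have : (2 : ℝ) ≤ h := by
      rw [hxh]
      calc (2 : ℝ) ≤ x := by linarith
        _ = x ^ 1 := by ring
        _ ≤ x ^ 100 := pow_le_pow_right₀ hx1 (by norm_num)
    exact_mod_cast this
  have hden : (0 : ℝ) < (h : ℝ) ^ h - h := by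
    have h1 : (h : ℝ) ^ 1 < (h : ℝ) ^ h :=
      pow_lt_pow_right₀ (by exact_mod_cast (by omega : 1 < h)) (by omega)
    rw [pow_one] at h1
    linarith
  refine hbound.trans ?_
  have h4 : 4 / (h : ℝ) ^ ((h : ℝ) ^ (1 / 3 : ℝ)) = 4 * η := by rw [hη]; ring
  rw [h4, ← mul_assoc, mul_one_div]
  gcongr
  · linarith
  · norm_num

end
end Inducibility

theorem theorem1p3 :
    ∃ h₀ : ℕ, ∀ h : ℕ, h₀ < h → ∀ H : SimpleGraph (Fin h),
      Inducibility.StronglyAsymmetric H →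
        Tendsto (Inducibility.maxInducedDensity H) atTop (𝓝 (Inducibility.inducibility H)) ∧
        Inducibility.inducibility H ≤
          ((h.factorial : ℝ) / ((h : ℝ) ^ h - h)) *
            (1 + 4 / (h : ℝ) ^ ((h : ℝ) ^ (1 / 3 : ℝ))) := by
  obtain ⟨h₀, hh₀⟩ := eventually_atTop.1 Inducibility.eventually_large
  refine ⟨h₀, fun h hh H hH => ⟨Inducibility.tendsto_maxInducedDensity H, ?_⟩⟩
  obtain ⟨h1, h2⟩ := hh₀ h hh.le
  exact Inducibility.inducibility_le hH h1 h2
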